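/- Let $n\ge 0$ and let $d\mu(z)=\pi^{-n}e^{-|z|^2}\,dV(z)$ be the normalized Gaussian measure on $\mathbb{C}^n$. Let $F^2$ be the Fock space of all entire functions in $L^2(\mathbb{C}^n,d\mu)$, $P$ the orthogonal projection of $L^2(\mathbb{C}^n,d\mu)$ onto $F^2$, and $K(z,w)=e^{z\cdot\overline{w}}$, where $z\cdot\overline{w}=\sum_k z_k\overline{w_k}$. For $c\in\mathbb{R}$ let $\mathcal{D}_c$ be the set of measurable $u:\mathbb{C}^n\to\mathbb{C}$ such that $u(z)e^{-c|z|^2}$ is essentially bounded, and let $\mathrm{Sym}(\mathbb{C}^n)=\bigcap_{c>0}\mathcal{D}_c$. For a measurable function $\varphi$ let $T_\varphi h=P(\varphi h)$ be the Toeplitz operator on $F^2$ with the (natural) domain $\{h\in F^2:\varphi h\in L^2(\mathbb{C}^n,d\mu)\}$; sums and products of such operators carry their natural domains. Write also $T^{\rm int}_\varphi h(z)=\int_{\mathbb{C}^n}\varphi(w)h(w)K(z,w)\,d\mu(w)$ whenever these integrals converge absolutely for all $z$; this is the integral form of $T_\varphi h$. For entire functions $f,g$ put $g^*(z)=\overline{g(\overline{z})}=\sum_i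 c_i z^i$ and $$g^*(\overline{z}-\partial_z)f(z)=\sum_{i\in\mathbb{N}^n}c_i\,(\overline{z}-\partial_z)^if(z),\qquad (\overline{z}-\partial_z)^if(z)=\sum_{l\le i}\binom{i}{l}\,\overline{z}^{\,l}\,(-\partial_z)^{i-l}f(z),$$ where $\binom{i}{l}=\prod_k\binom{i_k}{l_k}$. Let $f_1,\dots,f_N,g_1,\dots,g_N\in\mathrm{Sym}(\mathbb{C}^n)$ be entire. Then the series defining $u_l(z)=g_l^*(\overline{z}-\partial_z)f_l(z)$ converges absolutely at every $z\in\mathbb{C}^n$, we have $u_l\in\mathrm{Sym}(\mathbb{C}^n)$, and $$\sum_{l=1}^N T_{f_l}T_{\overline{g_l}}=\sum_{l=1}^N T_{u_l}=T_{u_1+\dots+u_N}$$ on the Fock space, in both of the following senses. (a) For every $h\in F^2$ the integrals defining $T^{\rm int}_{\overline{g_l}}h$, $T^{\rm int}_{f_l}T^{\rm int}_{\overline{g_l}}h$ and $T^{\rm int}_{u_l}h$ converge absolutely at every point of $\mathbb{C}^n$, and $$\sum_{l=1}^N T^{\rm int}_{f_l}T^{\rm int}_{\overline{g_l}}h=\sum_{l=1}^N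 T^{\rm int}_{u_l}h=T^{\rm int}_{u_1+\dots+u_N}h .$$ (b) The set of all entire functions that belong to $\mathcal{D}_c$ for some $c<1/2$ is dense in $F^2$ and is contained in the domains of the three operators $\sum_l T_{f_l}T_{\overline{g_l}}$, $\sum_l T_{u_l}$ and $T_{u_1+\dots+u_N}$. The first of these operators agrees with the second on the whole intersection of their two domains, and with the third on the whole intersection of their two domains. -/

import Mathlib

open MeasureTheory Filter Topology
open scoped ENNReal ComplexConjugate

namespace Fock

/-- The space `ℂⁿ` with its Euclidean norm. -/
abbrev Cn (n : ℕ) : Type := EuclideanSpace ℂ (Fin n)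

/-- The normalized Gaussian measure `dμ(z) = π⁻ⁿ exp(-|z|²) dV(z)` on `ℂⁿ`. -/
noncomputable def gaussian (n : ℕ) : Measure (Cn n) :=
  (volume : Measure (Cn n)).withDensity
    (fun z => ENNReal.ofReal ((Real.pi ^ n)⁻¹ * Real.exp (-‖z‖ ^ 2)))

/-- The reproducing kernel `K(z, w) = exp(z · w̄)`; recall that `inner ℂ w z = ∑ᵢ zᵢ w̄ᵢ`. -/
noncomputable def kernel {n : ℕ} (z w : Cn n) : ℂ := Complex.exp (inner ℂ w z)

lemma kernel_eq {n : ℕ} (z w : Cn n) :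
    kernel z w = Complex.exp (∑ i, z i * conj (w i)) := by
  simp [kernel, PiLp.inner_apply]

/-! ### The Fock space is closed in `L²` -/

lemma gaussian_density_cont (n : ℕ) :
    Continuous (fun z : Cn n => (Real.pi ^ n)⁻¹ * Real.exp (-‖z‖ ^ 2)) := by
  fun_prop

lemma integral_gaussian {n : ℕ} (G : Cn n → ℂ) :
    ∫ w, G w ∂(gaussian n) =
      ∫ w, (((Real.pi ^ n)⁻¹ * Real.exp (-‖w‖ ^ 2) : ℝ) : ℂ) * G w := by
  rw [gaussian, integral_withDensity_eq_integral_toReal_smul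
    (gaussian_density_cont n).measurable.ennreal_ofReal (by simp)]
  refine integral_congr_ae (ae_of_all _ fun w => ?_)
  simp only
  rw [ENNReal.toReal_ofReal (by positivity), Complex.real_smul]

lemma integrable_gaussian_iff {n : ℕ} {G : Cn n → ℂ} :
    Integrable G (gaussian n) ↔
      Integrable (fun w => (((Real.pi ^ n)⁻¹ * Real.exp (-‖w‖ ^ 2) : ℝ) : ℂ) * G w) := by
  rw [gaussian, integrable_withDensity_iff_integrable_smul₀'
    (gaussian_density_cont n).measurable.ennreal_ofReal.aemeasurable (by simp)]
  refine integrable_congr (ae_of_all _ fun w => ?_)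
  simp only
  rw [ENNReal.toReal_ofReal (by positivity), Complex.real_smul]

lemma memLp_quarter (n : ℕ) :
    MemLp (fun w : Cn n => Real.exp (‖w‖ ^ 2 / 4)) 2 (gaussian n) := by
  rw [memLp_two_iff_integrable_sq (by fun_prop)]
  have h := GaussianFourier.integrable_cexp_neg_mul_sq_norm_add
    (b := ((1 / 2 : ℝ) : ℂ)) (V := Cn n) (by norm_num) 0 0
  rw [gaussian, integrable_withDensity_iff_integrable_smul₀'
    (gaussian_density_cont n).measurable.ennreal_ofReal.aemeasurable (by simp)]
  have h2 := (h.norm).const_mul ((Real.pi ^ n)⁻¹)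
  refine h2.congr (ae_of_all _ fun w => ?_)
  simp only
  rw [ENNReal.toReal_ofReal (by positivity), Complex.norm_exp, smul_eq_mul, mul_assoc,
    ← Real.exp_nat_mul, ← Real.exp_add]
  congr 2
  have : (-((1 / 2 : ℝ) : ℂ) * (‖w‖ : ℂ) ^ 2 + 0 * ((inner ℝ (0 : Cn n) w : ℝ) : ℂ))
      = ((-(1 / 2) * ‖w‖ ^ 2 : ℝ) : ℂ) := by push_cast; ring
  rw [this, Complex.ofReal_re]
  push_cast; ring

instance gaussian_finite (n : ℕ) : IsFiniteMeasure (gaussian n) := by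
  have h := (memLp_quarter n)
  have h2 : MemLp (fun _ : Cn n => (1 : ℝ)) 2 (gaussian n) := by
    refine h.mono (by fun_prop) (ae_of_all _ fun w => ?_)
    simp only [norm_one, Real.norm_eq_abs, Real.abs_exp]
    exact Real.one_le_exp (by positivity)
  have h3 := (memLp_const_iff (p := 2) (by simp) (by simp)).1 h2
  exact ⟨by simpa using h3⟩

lemma exp_lin_le (R t : ℝ) : Real.exp (R * t) ≤ Real.exp (R ^ 2) * Real.exp (t ^ 2 / 4) := by
  rw [← Real.exp_add]
  exact Real.exp_le_exp.2 (by nlinarith [sq_nonneg (R - t / 2)])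

lemma memLp_exp_lin (n : ℕ) (R : ℝ) :
    MemLp (fun w : Cn n => Real.exp (R * ‖w‖)) 2 (gaussian n) := by
  refine ((memLp_quarter n).const_mul (Real.exp (R ^ 2))).mono (by fun_prop)
    (ae_of_all _ fun w => ?_)
  simp only [Real.norm_eq_abs, Real.abs_exp, abs_mul]
  exact exp_lin_le R ‖w‖

lemma kernel_continuous {n : ℕ} (z : Cn n) : Continuous (fun w => kernel z w) := by
  unfold kernel; fun_prop

lemma norm_kernel_le {n : ℕ} (z w : Cn n) : ‖kernel z w‖ ≤ Real.exp (‖z‖ * ‖w‖) := by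
  rw [kernel, Complex.norm_exp]
  refine Real.exp_le_exp.2 ((Complex.re_le_norm _).trans ?_)
  rw [mul_comm]
  exact norm_inner_le_norm w z

lemma memLp_kernel {n : ℕ} (z : Cn n) : MemLp (fun w => kernel z w) 2 (gaussian n) := by
  refine (memLp_exp_lin n ‖z‖).mono (kernel_continuous z).aestronglyMeasurable
    (ae_of_all _ fun w => ?_)
  rw [Real.norm_eq_abs, Real.abs_exp]
  exact norm_kernel_le z w

/-- Mean value property for the rotation invariant measure `μ`. -/
lemma integral_entire {n : ℕ} {G : Cn n → ℂ} (hG : Differentiable ℂ G)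
    (hi : Integrable G (gaussian n)) : ∫ w, G w ∂(gaussian n) =
      (∫ w : Cn n, (((Real.pi ^ n)⁻¹ * Real.exp (-‖w‖ ^ 2) : ℝ) : ℂ)) * G 0 := by
  set ρ : Cn n → ℂ := fun w => (((Real.pi ^ n)⁻¹ * Real.exp (-‖w‖ ^ 2) : ℝ) : ℂ) with hρ
  have hρc : Continuous ρ := Complex.continuous_ofReal.comp (gaussian_density_cont n)
  have hi' : Integrable (fun w => ρ w * G w) := integrable_gaussian_iff.1 hi
  rw [integral_gaussian, ← integral_mul_const]
  change ∫ w, ρ w * G w = ∫ w, ρ w * G 0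
  let μ' : Measure ℝ := volume.restrict (Set.Ioc 0 (2 * Real.pi))
  have : IsFiniteMeasure μ' := inferInstanceAs
    (IsFiniteMeasure (volume.restrict (Set.Ioc 0 (2 * Real.pi))))
  have hnorm : ∀ (θ : ℝ) (w : Cn n), ‖Circle.exp θ • w‖ = ‖w‖ := fun θ w => by
    rw [Circle.smul_def, norm_smul]; simp
  have hρr : ∀ (θ : ℝ) (w : Cn n), ρ (Circle.exp θ • w) = ρ w := fun θ w => by
    simp only [hρ, hnorm]
  let rot : ℝ → Cn n ≃ₗᵢ[ℝ] Cn n := fun θ =>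
    { DistribMulAction.toLinearEquiv ℝ (Cn n) (Circle.exp θ) with
      norm_map' := fun w => hnorm θ w }
  have hmp : ∀ θ : ℝ, MeasurePreserving (fun w : Cn n => Circle.exp θ • w) volume volume :=
    fun θ => (rot θ).measurePreserving
  have hemb : ∀ θ : ℝ, MeasurableEmbedding (fun w : Cn n => Circle.exp θ • w) :=
    fun θ => (rot θ).toHomeomorph.measurableEmbedding
  have hrot : ∀ θ : ℝ, ∫ w, ρ w * G (Circle.exp θ • w) = ∫ w, ρ w * G w := fun θ => by
    rw [← (hmp θ).integral_comp (hemb θ) (fun w => ρ w * G w)]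
    simp only [hρr]
  have hcont : Continuous (fun p : ℝ × Cn n => ρ p.2 * G (Circle.exp p.1 • p.2)) :=
    (hρc.comp continuous_snd).mul (hG.continuous.comp
      ((Circle.exp.continuous.comp continuous_fst).smul continuous_snd))
  have hprod : Integrable (fun p : ℝ × Cn n => ρ p.2 * G (Circle.exp p.1 • p.2))
      (μ'.prod volume) := by
    rw [integrable_prod_iff hcont.aestronglyMeasurable]
    have e : ∀ θ : ℝ, Integrable (fun w => ρ w * G (Circle.exp θ • w)) := fun θ => by
      have := (hmp θ).integrable_comp_of_integrable hi'
      refine this.congr (ae_of_all _ fun w => ?_)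
      simp only [Function.comp, hρr]
    refine ⟨ae_of_all _ e, ?_⟩
    have e2 : ∀ θ : ℝ, ∫ w, ‖ρ w * G (Circle.exp θ • w)‖ = ∫ w, ‖ρ w * G w‖ := fun θ => by
      rw [← (hmp θ).integral_comp (hemb θ) (fun w => ‖ρ w * G w‖)]
      simp only [hρr]
    simp only [e2]
    exact integrable_const _
  have hswap := integral_integral_swap (μ := μ') (ν := (volume : Measure (Cn n)))
    (f := fun θ w => ρ w * G (Circle.exp θ • w)) hprod
  have hinner : ∀ w : Cn n, ∫ θ, ρ w * G (Circle.exp θ • w) ∂μ' =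
      (2 * Real.pi) * (ρ w * G 0) := fun w => by
    have hd : Differentiable ℂ (fun ζ : ℂ => G (ζ • w)) :=
      hG.comp (differentiable_id.smul_const w)
    have hm := (hd.diffContOnCl (s := Metric.ball 0 |1|)).circleAverage
    rw [Real.circleAverage_def, zero_smul] at hm
    rw [integral_const_mul]
    have : ∫ θ, G (Circle.exp θ • w) ∂μ' = 2 * Real.pi * G 0 := by
      rw [← hm]
      rw [intervalIntegral.integral_of_le Real.two_pi_pos.le]
      have h2 : (2 * (Real.pi : ℂ)) ≠ 0 := by
        simp [Real.pi_ne_zero]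
      simp only [μ', Complex.real_smul, circleMap_zero, Circle.smul_def, Circle.coe_exp]
      push_cast
      rw [mul_inv_cancel_left₀ h2]
      simp
    rw [this]; ring
  simp only [hrot, hinner] at hswap
  rw [integral_const, integral_const_mul] at hswap
  have hμ : μ'.real Set.univ = 2 * Real.pi := by
    simp [μ', measureReal_def, Real.pi_pos.le]
  rw [hμ, Complex.real_smul] at hswap
  push_cast at hswap
  have h2 : (2 * (Real.pi : ℂ)) ≠ 0 := by
    simp [Real.pi_ne_zero]
  exact mul_left_cancel₀ h2 hswap

lemma integral_density (n : ℕ) :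
    (∫ w : Cn n, (((Real.pi ^ n)⁻¹ * Real.exp (-‖w‖ ^ 2) : ℝ) : ℂ)) = 1 := by
  have h := GaussianFourier.integral_rexp_neg_mul_sq_norm (V := Cn n) (b := 1) one_pos
  have hr : Module.finrank ℝ (Cn n) = 2 * n := by
    rw [← Module.finrank_mul_finrank ℝ ℂ (Cn n)]; simp
  rw [integral_complex_ofReal, integral_const_mul]
  simp only [neg_mul, one_mul] at h
  rw [h, hr]
  have : ((Real.pi / 1) ^ (((2 * n : ℕ) : ℝ) / 2) : ℝ) = Real.pi ^ n := by
    rw [div_one, ← Real.rpow_natCast]; congr 1; push_cast; ring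
  rw [this, inv_mul_cancel₀ (by positivity)]; simp

lemma reproducing {n : ℕ} {F : Cn n → ℂ} (hF : Differentiable ℂ F)
    (hi : MemLp F 2 (gaussian n)) (z : Cn n) :
    ∫ w, F w * kernel z w ∂(gaussian n) = F z := by
  set ρ : Cn n → ℂ := fun w => (((Real.pi ^ n)⁻¹ * Real.exp (-‖w‖ ^ 2) : ℝ) : ℂ) with hρ
  have hint : Integrable (fun w => F w * kernel z w) (gaussian n) :=
    hi.integrable_mul (memLp_kernel z)
  let G : Cn n → ℂ := fun w => F (w + z) * Complex.exp (-inner ℂ z w)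
  have hlin : Differentiable ℂ (fun w : Cn n => (inner ℂ z w : ℂ)) :=
    (innerSL ℂ z).differentiable
  have hG : Differentiable ℂ G :=
    (hF.comp (differentiable_id.add_const z)).mul hlin.neg.cexp
  have key : ∀ w, ρ w * G w = (fun w => ρ w * (F w * kernel z w)) (w + z) := fun w => by
    simp only [G, hρ, kernel]
    have e1 : (((Real.exp (-‖w‖ ^ 2) : ℝ) : ℂ)) * Complex.exp (-inner ℂ z w) =
        ((Real.exp (-‖w + z‖ ^ 2) : ℝ) : ℂ) * Complex.exp (inner ℂ (w + z) z) := by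
      rw [Complex.ofReal_exp, Complex.ofReal_exp, ← Complex.exp_add, ← Complex.exp_add]
      congr 1
      have h1 : ((‖w‖ : ℂ)) ^ 2 = inner ℂ w w := (inner_self_eq_norm_sq_to_K w).symm
      have h2 : ((‖w + z‖ : ℂ)) ^ 2 = inner ℂ (w + z) (w + z) :=
        (inner_self_eq_norm_sq_to_K (w + z)).symm
      push_cast
      rw [h1, h2]
      simp only [inner_add_left, inner_add_right]
      ring
    push_cast at e1 ⊢
    linear_combination ((Real.pi : ℂ) ^ n)⁻¹ * F (w + z) * e1
  have hGi : Integrable G (gaussian n) := by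
    rw [integrable_gaussian_iff]
    refine Integrable.congr ((integrable_gaussian_iff.1 hint).comp_add_right z)
      (ae_of_all _ fun w => (key w).symm)
  have h := integral_entire hG hGi
  rw [integral_density, one_mul, integral_gaussian] at h
  change ∫ w, ρ w * G w = _ at h
  simp only [key] at h
  rw [integral_add_right_eq_self (fun w => ρ w * (F w * kernel z w)) z] at h
  rw [integral_gaussian]
  refine h.trans ?_
  simp [G]

lemma differentiable_integral_kernel {n : ℕ} {h : Cn n → ℂ} (hh : MemLp h 2 (gaussian n)) :
    Differentiable ℂ (fun z => ∫ w, h w * kernel z w ∂(gaussian n)) := by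
  intro z₀
  let F' : Cn n → Cn n → (Cn n →L[ℂ] ℂ) := fun z w => (h w * kernel z w) • innerSL ℂ w
  refine (hasFDerivAt_integral_of_dominated_of_fderiv_le (𝕜 := ℂ)
    (F' := F') (bound := fun w => ‖h w‖ * Real.exp ((‖z₀‖ + 2) * ‖w‖))
    (Metric.ball_mem_nhds z₀ one_pos) ?_ ?_ ?_ ?_ ?_ ?_).differentiableAt
  · exact Eventually.of_forall fun z =>
      hh.1.mul (kernel_continuous z).aestronglyMeasurable
  · exact hh.integrable_mul (memLp_kernel z₀)
  · exact (hh.1.mul (kernel_continuous z₀).aestronglyMeasurable).smul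
      (innerSL ℂ).continuous.aestronglyMeasurable
  · refine ae_of_all _ fun w z hz => ?_
    simp only [F']
    rw [norm_smul, norm_mul, mul_assoc]
    refine mul_le_mul_of_nonneg_left ?_ (norm_nonneg _)
    have hz' : ‖z‖ ≤ ‖z₀‖ + 1 := by
      have := norm_sub_norm_le z z₀
      rw [Metric.mem_ball, dist_eq_norm] at hz
      linarith
    rw [innerSL_apply_norm]
    have h1 : ‖w‖ ≤ Real.exp ‖w‖ := by linarith [Real.add_one_le_exp ‖w‖]
    calc ‖kernel z w‖ * ‖w‖ ≤ Real.exp (‖z‖ * ‖w‖) * Real.exp ‖w‖ :=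
          mul_le_mul (norm_kernel_le z w) h1 (norm_nonneg _) (Real.exp_pos _).le
      _ = Real.exp (‖z‖ * ‖w‖ + ‖w‖) := (Real.exp_add _ _).symm
      _ ≤ _ := Real.exp_le_exp.2 (by nlinarith [norm_nonneg w])
  · exact hh.norm.integrable_mul (memLp_exp_lin n _)
  · refine ae_of_all _ fun w z _ => ?_
    have h1 : HasFDerivAt (fun z : Cn n => (inner ℂ w z : ℂ)) (innerSL ℂ w) z :=
      (innerSL ℂ w).hasFDerivAt
    have h2 := (h1.cexp).const_mul (h w)
    simpa [F', kernel, smul_smul] using h2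

/-- The Fock space `F²(ℂⁿ) = L²(ℂⁿ, dμ) ∩ H(ℂⁿ)`, as a subspace of `L²(ℂⁿ, dμ)`: the classes which
have an entire representative. -/
def fockSpace (n : ℕ) : Submodule ℂ (Lp ℂ 2 (gaussian n)) where
  carrier := {h | ∃ F : Cn n → ℂ, Differentiable ℂ F ∧ h =ᵐ[gaussian n] F}
  add_mem' := by
    rintro a b ⟨F, hF, ha⟩ ⟨G, hG, hb⟩
    exact ⟨F + G, hF.add hG, (Lp.coeFn_add a b).trans (ha.add hb)⟩
  zero_mem' := ⟨0, differentiable_const 0, Lp.coeFn_zero _ _ _⟩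
  smul_mem' := by
    rintro c a ⟨F, hF, ha⟩
    exact ⟨c • F, hF.const_smul c, (Lp.coeFn_smul c a).trans (ha.const_smul c)⟩

lemma fockSpace_isClosed (n : ℕ) : IsClosed (fockSpace n : Set (Lp ℂ 2 (gaussian n))) := by
  refine isClosed_of_closure_subset fun h hh => ?_
  obtain ⟨a, ha, hlim⟩ := mem_closure_iff_seq_limit.1 hh
  choose F hF haF using ha
  let k : Cn n → Lp ℂ 2 (gaussian n) := fun z =>
    ((memLp_kernel z).star).toLp (fun w => star (kernel z w))
  have hk : ∀ (z : Cn n) (u : Lp ℂ 2 (gaussian n)),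
      inner ℂ (k z) u = ∫ w, u w * kernel z w ∂(gaussian n) := fun z u => by
    rw [L2.inner_def]
    refine integral_congr_ae ?_
    filter_upwards [((memLp_kernel z).star).coeFn_toLp] with w hw
    simp only [k, RCLike.inner_apply]
    erw [hw]
    simp
  have hFz : ∀ m z, F m z = inner ℂ (k z) (a m) := fun m z => by
    rw [hk, ← reproducing (hF m) ((memLp_congr_ae (haF m)).1 (Lp.memLp (a m))) z]
    refine integral_congr_ae ?_
    filter_upwards [haF m] with w hw
    rw [hw]
  refine ⟨fun z => ∫ w, h w * kernel z w ∂(gaussian n),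
    differentiable_integral_kernel (Lp.memLp h), ?_⟩
  obtain ⟨ns, hns, hae⟩ :=
    (tendstoInMeasure_of_tendsto_Lp hlim).exists_seq_tendsto_ae
  have hall : ∀ᵐ w ∂(gaussian n), ∀ m, (a m : Cn n → ℂ) w = F m w :=
    ae_all_iff.2 fun m => haF m
  filter_upwards [hae, hall] with z hz hz'
  have h1 : Tendsto (fun m => (a (ns m) : Cn n → ℂ) z) atTop (𝓝 (inner ℂ (k z) h)) := by
    simp only [hz', hFz]
    exact (tendsto_const_nhds.inner hlim).comp hns.tendsto_atTop
  rw [← hk]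
  exact tendsto_nhds_unique hz h1

instance fockSpace_complete (n : ℕ) : CompleteSpace (fockSpace n) :=
  (fockSpace_isClosed n).completeSpace_coe

/-! ### Symbols -/

/-- `𝒟_c`: the measurable `u` on `ℂⁿ` such that `u(z) exp(-c|z|²)` is essentially bounded. -/
def growthSpace (n : ℕ) (c : ℝ) : Set (Cn n → ℂ) :=
  {u | Measurable u ∧ ∃ C : ℝ, ∀ᵐ z ∂(volume : Measure (Cn n)),
    ‖u z * (Real.exp (-c * ‖z‖ ^ 2) : ℂ)‖ ≤ C}

/-- `Sym(ℂⁿ) = ⋂_{c > 0} 𝒟_c`. -/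
def symSpace (n : ℕ) : Set (Cn n → ℂ) := {u | ∀ c : ℝ, 0 < c → u ∈ growthSpace n c}

/-- `H(ℂⁿ)`: the entire functions. -/
def entire (n : ℕ) : Set (Cn n → ℂ) := {f | Differentiable ℂ f}

/-- The complex partial derivative `∂_j f` of a holomorphic function `f`. -/
noncomputable def partialDeriv {n : ℕ} (j : Fin n) (f : Cn n → ℂ) : Cn n → ℂ :=
  fun z => fderiv ℂ f z (EuclideanSpace.single j 1)

/-- `∂^i f = ∂_1^{i_1} ⋯ ∂_n^{i_n} f`. -/
noncomputable def multiDeriv {n : ℕ} (i : Fin n → ℕ) (f : Cn n → ℂ) : Cn n → ℂ :=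
  (List.finRange n).foldr (fun j φ => (partialDeriv j)^[i j] φ) f

/-- `f*(z) = conj (f (z̄))`. -/
def starFn {n : ℕ} (f : Cn n → ℂ) : Cn n → ℂ :=
  fun z => conj (f (WithLp.toLp 2 fun j => conj (z j)))

/-- The coefficient of `z^i` in the power series at the origin of an entire function `G`. -/
noncomputable def coeff {n : ℕ} (G : Cn n → ℂ) (i : Fin n → ℕ) : ℂ :=
  multiDeriv i G 0 / ((∏ k, (i k).factorial : ℕ) : ℂ)

/-- `((z̄ - ∂_z)^i f)(z) = ∑_{l ≤ i} C(i, l) z̄^l ((-∂_z)^{i - l} f)(z)`, where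
`C(i, l) = ∏_k C(i_k, l_k)`; here `i - l` is exact because `l ≤ i`. -/
noncomputable def conjSubDeriv {n : ℕ} (i : Fin n → ℕ) (f : Cn n → ℂ) (z : Cn n) : ℂ :=
  ∑ l ∈ Finset.Iic i, ((∏ k, (i k).choose (l k) : ℕ) : ℂ) * (∏ k, conj (z k) ^ l k) *
    ((-1) ^ (∑ k, (i k - l k)) * multiDeriv (i - l) f z)

/-- The `i`-th term of the series `G(z̄ - ∂_z) f(z) = ∑_i c_i (z̄ - ∂_z)^i f(z)`, where
`G(w) = ∑_i c_i w^i`. -/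
noncomputable def opTerm {n : ℕ} (G f : Cn n → ℂ) (z : Cn n) (i : Fin n → ℕ) : ℂ :=
  coeff G i * conjSubDeriv i f z

/-- The function `z ↦ G(z̄ - ∂_z) f(z)`. -/
noncomputable def opSymbol {n : ℕ} (G f : Cn n → ℂ) : Cn n → ℂ := fun z => ∑' i, opTerm G f z i

/-- The symbol `g*(z̄ - ∂_z) f(z)`. -/
noncomputable def prodSymbol {n : ℕ} (f g : Cn n → ℂ) : Cn n → ℂ := opSymbol (starFn g) f

/-- The pointwise conjugate `ḡ`. -/
def conjFn {n : ℕ} (g : Cn n → ℂ) : Cn n → ℂ := fun z => conj (g z)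

/-! ### Toeplitz operators -/

/-- The operator `M_φ` of multiplication by `φ` on `L²(ℂⁿ, dμ)`, with its natural domain
`{h ∈ L² : φ h ∈ L²}`. -/
noncomputable def mulOp {n : ℕ} (φ : Cn n → ℂ) :
    Lp ℂ 2 (gaussian n) →ₗ.[ℂ] Lp ℂ 2 (gaussian n) where
  domain :=
    { carrier := {h | MemLp (fun w => φ w * h w) 2 (gaussian n)}
      add_mem' := by
        intro a b ha hb
        refine (memLp_congr_ae ?_).1 (MemLp.add ha hb)
        filter_upwards [Lp.coeFn_add a b] with w hw
        rw [hw]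
        simp [mul_add]
      zero_mem' := by
        refine (memLp_congr_ae ?_).1 (MemLp.zero (p := 2) (μ := gaussian n) (ε := ℂ))
        filter_upwards [Lp.coeFn_zero ℂ 2 (gaussian n)] with w hw
        rw [hw]
        simp
      smul_mem' := by
        intro c a ha
        refine (memLp_congr_ae ?_).1 (MemLp.const_smul ha c)
        filter_upwards [Lp.coeFn_smul c a] with w hw
        rw [hw]
        simp [mul_left_comm] }
  toFun :=
    { toFun := fun h => MemLp.toLp (fun w => φ w * h.1 w) h.2
      map_add' := by
        rintro ⟨a, ha⟩ ⟨b, hb⟩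
        rw [← MemLp.toLp_add]
        refine MemLp.toLp_congr _ _ ?_
        filter_upwards [Lp.coeFn_add a b] with w hw
        simp only [Submodule.coe_add, Pi.add_apply]
        rw [hw, Pi.add_apply, mul_add]
      map_smul' := by
        rintro c ⟨a, ha⟩
        rw [RingHom.id_apply, ← MemLp.toLp_const_smul]
        refine MemLp.toLp_congr _ _ ?_
        filter_upwards [Lp.coeFn_smul c a] with w hw
        simp only [Submodule.coe_smul, Pi.smul_apply, smul_eq_mul]
        rw [hw, Pi.smul_apply, smul_eq_mul, mul_left_comm] }

/-- The (in general unbounded) Toeplitz operator `T_φ = P M_φ` on the Fock space with its natural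
domain `{h ∈ F² : φ h ∈ L²}`, where `P` is the orthogonal projection of `L²` onto `F²`. -/
noncomputable def toeplitz {n : ℕ} (φ : Cn n → ℂ) : fockSpace n →ₗ.[ℂ] fockSpace n where
  domain := (mulOp φ).domain.comap (fockSpace n).subtype
  toFun := ((fockSpace n).orthogonalProjectionOnto : Lp ℂ 2 (gaussian n) →ₗ[ℂ] fockSpace n) ∘ₗ
    (mulOp φ).toFun ∘ₗ ((fockSpace n).subtype.restrict fun _ h => h)

/-- The product `S T` of unbounded operators, with its natural domain
`{h ∈ dom T : T h ∈ dom S}`. -/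
noncomputable def opMul {E : Type*} [AddCommGroup E] [Module ℂ E] (S T : E →ₗ.[ℂ] E) :
    E →ₗ.[ℂ] E where
  domain := (S.domain.comap T.toFun).map T.domain.subtype
  toFun := S.toFun ∘ₗ
    { toFun := fun h => ⟨T ⟨h, by obtain ⟨x, _, hx⟩ := h.2; exact hx ▸ x.2⟩, by
        obtain ⟨_, x, hx, rfl⟩ := h; exact hx⟩
      map_add' := fun a b => Subtype.ext (T.map_add ⟨a, _⟩ ⟨b, _⟩)
      map_smul' := fun c a => Subtype.ext (T.map_smul c ⟨a, _⟩) }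

/-- The Toeplitz operator in integral form, `(T_φ h)(z) = ∫ φ(w) h(w) K(z, w) dμ(w)`, which makes
sense for every `h` for which the integrals converge. -/
noncomputable def toeplitzInt {n : ℕ} (φ h : Cn n → ℂ) : Cn n → ℂ :=
  fun z => ∫ w, φ w * h w * kernel z w ∂(gaussian n)

/-- The integrals which define `T_φ h` converge. -/
def ToeplitzConv {n : ℕ} (φ h : Cn n → ℂ) : Prop :=
  ∀ z, Integrable (fun w => φ w * h w * kernel z w) (gaussian n)

/-- `S` and `T` coincide wherever both are defined, and both are defined on all of `D`. -/
def AgreeOn {E : Type*} [AddCommGroup E] [Module ℂ E] (D : Set E) (S T : E →ₗ.[ℂ] E) : Prop :=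
  D ⊆ S.domain ∧ D ⊆ T.domain ∧
    ∀ (h : E) (hS : h ∈ S.domain) (hT : h ∈ T.domain), S ⟨h, hS⟩ = T ⟨h, hT⟩

/-- The `h ∈ F²` with an entire representative in `𝒟_c` for some `c < 1/2`; in particular
all polynomials and all kernel functions. -/
def fockCore (n : ℕ) : Set (fockSpace n) :=
  {h | ∃ c : ℝ, c < 1 / 2 ∧ ∃ F ∈ entire n ∩ growthSpace n c,
    ((h : Lp ℂ 2 (gaussian n)) : Cn n → ℂ) =ᵐ[gaussian n] F}

end Fock

/-! Two facts about the Gaussian measure carry the theorem. First, the reproducing formula `∫ F(w)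
K(z,w) dμ(w) = F(z)` holds for every entire `F` bounded by `C exp(c|w|²)` with some `c < 1`, not
only for `F ∈ F²`. Second, `K(z+t,w) = K(z,w) K(t,w)`. Write `u` for the symbol of one pair `f, g`.

The first fact makes `T_f` act on `T_{conj g} h` as multiplication by `f`, and with Fubini it gives
`T_{conj g} h(z) = ∫ conj(g(t)) h(z+t) dμ(t)` (`toeplitzInt_conjFn`). The symbol has a similar form:
`u(w) = ∫ conj(g(t)) f(w-t) K(t,w) dμ(t)` (`prodSymbol_eq_integral`). Substituting this in `T_u
h(z)` and applying Fubini leaves the inner integral of `f(w-t) h(w) K(z+t,w)` over `w`, which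
reproduces `f(z) h(z+t)`; hence `T_u h = f · T_{conj g} h` (`toeplitzInt_prodSymbol`).

The formula for `u` comes from the pairing `∑ c_i ∂^i F(0) = ∫ conj(g) F dμ` (`hasSum_pairing`):
derivatives at the origin are moments against `w̄^i`, and the series over `i` sums to an
exponential. It is applied to `F(t) = f(z-t) K(t,z)`, whose derivatives at `0` are `(z̄-∂_z)^i f(z)`
(`conjSubDeriv_eq`). The pairing is unchanged when `g` and `F` are dilated by inverse factors, and
this freedom gives `u ∈ Sym`.

For the unbounded operators, `P` is integration against `K`, so the Hilbert space operators agree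
almost everywhere with the integral ones on their natural domains. Elements of `F²` grow at most
like `exp(|z|²/2)`, so the integral identity covers all of them. -/

namespace Fock

variable {n : ℕ}

/-! ### Gaussian growth bounds -/

/-- `‖H w‖ ≤ C exp(c ‖w‖²)` everywhere, for some constant `C`. -/
def GrowthBound (c : ℝ) (H : Cn n → ℂ) : Prop :=
  ∃ C : ℝ, 0 ≤ C ∧ ∀ w, ‖H w‖ ≤ C * Real.exp (c * ‖w‖ ^ 2)

lemma GrowthBound.mono {c d : ℝ} {H : Cn n → ℂ} (h : GrowthBound c H) (hcd : c ≤ d) :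
    GrowthBound d H := by
  obtain ⟨C, hC, hH⟩ := h
  refine ⟨C, hC, fun w => (hH w).trans ?_⟩
  gcongr

lemma GrowthBound.mul {c d : ℝ} {H K : Cn n → ℂ} (h : GrowthBound c H) (k : GrowthBound d K) :
    GrowthBound (c + d) (fun w => H w * K w) := by
  obtain ⟨C, hC, hH⟩ := h
  obtain ⟨D, hD, hK⟩ := k
  refine ⟨C * D, by positivity, fun w => ?_⟩
  rw [norm_mul, add_mul, Real.exp_add, mul_mul_mul_comm]
  exact mul_le_mul (hH w) (hK w) (norm_nonneg _) (by positivity)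

lemma GrowthBound.add {c d : ℝ} {H K : Cn n → ℂ} (h : GrowthBound c H) (k : GrowthBound d K) :
    GrowthBound (max c d) (fun w => H w + K w) := by
  obtain ⟨C, hC, hH⟩ := h.mono (le_max_left c d)
  obtain ⟨D, hD, hK⟩ := k.mono (le_max_right c d)
  refine ⟨C + D, by positivity, fun w => ?_⟩
  rw [add_mul]
  exact (norm_add_le _ _).trans (add_le_add (hH w) (hK w))

/-- The difference of the two sides is a square. The weight `ε` decides how a cross term `|z||w|` in
an exponent is shared between the two variables. -/
lemma mul_le_weighted (a t : ℝ) {ε : ℝ} (hε : 0 < ε) : a * t ≤ a ^ 2 / (4 * ε) + ε * t ^ 2 := by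
  have h : a ^ 2 / (4 * ε) + ε * t ^ 2 - a * t = (a - 2 * ε * t) ^ 2 / (4 * ε) := by
    field_simp; ring
  have : 0 ≤ (a - 2 * ε * t) ^ 2 / (4 * ε) := by positivity
  linarith

lemma growthBound_of_norm_le_exp {H : Cn n → ℂ} {a : ℝ} (h : ∀ w, ‖H w‖ ≤ Real.exp (a * ‖w‖))
    {ε : ℝ} (hε : 0 < ε) : GrowthBound ε H := by
  refine ⟨Real.exp (a ^ 2 / (4 * ε)), by positivity, fun w => (h w).trans ?_⟩
  rw [← Real.exp_add]
  exact Real.exp_le_exp.2 (mul_le_weighted a ‖w‖ hε)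

/-- Measurable functions of order less than `exp(c ‖w‖²)` for every `c > 0`. -/
structure Tame (φ : Cn n → ℂ) : Prop where
  measurable : Measurable φ
  growth : ∀ ε : ℝ, 0 < ε → GrowthBound ε φ

lemma Tame.mul {φ ψ : Cn n → ℂ} (h : Tame φ) (k : Tame ψ) : Tame (fun w => φ w * ψ w) :=
  ⟨h.measurable.mul k.measurable, fun ε hε => by
    simpa using (h.growth (ε / 2) (by positivity)).mul (k.growth (ε / 2) (by positivity))⟩

lemma tame_kernel (z : Cn n) : Tame (fun w => kernel z w) :=
  ⟨(kernel_continuous z).measurable, fun _ hε =>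
    growthBound_of_norm_le_exp (fun w => norm_kernel_le z w) hε⟩

lemma tame_exp (a : ℝ) : Tame (fun w : Cn n => ((Real.exp (a * ‖w‖) : ℝ) : ℂ)) :=
  ⟨by fun_prop, fun _ hε => growthBound_of_norm_le_exp (a := a) (fun w => by
    rw [Complex.norm_real, Real.norm_eq_abs, Real.abs_exp]) hε⟩

lemma tame_conj_coord (j : Fin n) : Tame (fun w : Cn n => conj (w j)) :=
  ⟨by fun_prop, fun _ hε => growthBound_of_norm_le_exp (a := 1) (fun w => by
    rw [RCLike.norm_conj, one_mul]
    linarith [PiLp.norm_apply_le w j, Real.add_one_le_exp ‖w‖]) hε⟩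

lemma Tame.conj {φ : Cn n → ℂ} (h : Tame φ) : Tame (conjFn φ) :=
  ⟨Complex.continuous_conj.measurable.comp h.measurable, fun ε hε => by
    simpa [GrowthBound, conjFn] using h.growth ε hε⟩

/-- Measurable functions bounded by a multiple of `exp(c ‖w‖²)` for some `c < 1`; they are
integrable with respect to the Gaussian measure. -/
structure SubGaussian (H : Cn n → ℂ) : Prop where
  measurable : Measurable H
  growth : ∃ c : ℝ, c < 1 ∧ GrowthBound c H

lemma Tame.subGaussian {φ : Cn n → ℂ} (h : Tame φ) : SubGaussian φ :=
  ⟨h.measurable, 1 / 2, by norm_num, h.growth _ (by norm_num)⟩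

lemma SubGaussian.mul_tame {H φ : Cn n → ℂ} (h : SubGaussian H) (k : Tame φ) :
    SubGaussian (fun w => H w * φ w) := by
  obtain ⟨c, hc, hH⟩ := h.growth
  -- Half of the gap between `c` and `1` is spent on `φ`.
  exact ⟨h.measurable.mul k.measurable, _, by linarith,
    hH.mul (k.growth ((1 - c) / 2) (by linarith))⟩

lemma Tame.mul_subGaussian {H φ : Cn n → ℂ} (k : Tame φ) (h : SubGaussian H) :
    SubGaussian (fun w => φ w * H w) := by
  simpa only [mul_comm] using h.mul_tame k

/-! ### Integrability against the Gaussian measure -/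

lemma integrable_exp_sq {c : ℝ} (hc : c < 1) :
    Integrable (fun w : Cn n => Real.exp (c * ‖w‖ ^ 2)) (gaussian n) := by
  have h := GaussianFourier.integrable_cexp_neg_mul_sq_norm_add
    (b := ((1 - c : ℝ) : ℂ)) (V := Cn n) (by simpa using hc) 0 0
  rw [gaussian, integrable_withDensity_iff_integrable_smul₀'
    (gaussian_density_cont n).measurable.ennreal_ofReal.aemeasurable (by simp)]
  have h2 := (h.norm).const_mul ((Real.pi ^ n)⁻¹)
  refine h2.congr (ae_of_all _ fun w => ?_)
  simp only
  rw [ENNReal.toReal_ofReal (by positivity), Complex.norm_exp, smul_eq_mul, mul_assoc,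
    ← Real.exp_add]
  congr 2
  have : (-((1 - c : ℝ) : ℂ) * (‖w‖ : ℂ) ^ 2 + 0 * ((inner ℝ (0 : Cn n) w : ℝ) : ℂ))
      = ((-(1 - c) * ‖w‖ ^ 2 : ℝ) : ℂ) := by push_cast; ring
  rw [this, Complex.ofReal_re]
  ring

lemma SubGaussian.integrable {H : Cn n → ℂ} (h : SubGaussian H) : Integrable H (gaussian n) := by
  obtain ⟨c, hc, C, hC, hH⟩ := h.growth
  refine ((integrable_exp_sq hc).const_mul C).mono h.measurable.aestronglyMeasurable
    (ae_of_all _ fun w => (hH w).trans (le_abs_self _))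

/-- Squaring doubles the exponent, so the threshold `1` for integrability becomes `1/2`. -/
lemma memLp_two_of_growthBound {H : Cn n → ℂ} (hm : Measurable H) {c : ℝ} (hc : c < 1 / 2)
    (h : GrowthBound c H) : MemLp H 2 (gaussian n) := by
  obtain ⟨C, hC, hH⟩ := h
  have : MemLp (fun w : Cn n => Real.exp (c * ‖w‖ ^ 2)) 2 (gaussian n) := by
    rw [memLp_two_iff_integrable_sq (by fun_prop)]
    refine (integrable_exp_sq (n := n) (c := 2 * c) (by linarith)).congr (ae_of_all _ fun w => ?_)
    simp only [← Real.exp_nat_mul]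
    congr 1; push_cast; ring
  refine (this.const_mul C).mono hm.aestronglyMeasurable
    (ae_of_all _ fun w => (hH w).trans (le_abs_self _))

lemma integrable_prod_of_le {Φ : Cn n × Cn n → ℂ} (hm : Measurable Φ) {a b C : ℝ} (ha : a < 1)
    (hb : b < 1) (h : ∀ p, ‖Φ p‖ ≤ C * Real.exp (a * ‖p.1‖ ^ 2 + b * ‖p.2‖ ^ 2)) :
    Integrable Φ ((gaussian n).prod (gaussian n)) := by
  refine (((integrable_exp_sq ha).mul_prod (integrable_exp_sq hb)).const_mul C).mono
    hm.aestronglyMeasurable (ae_of_all _ fun p => (h p).trans ?_)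
  rw [Real.exp_add]
  exact le_abs_self _

/-! ### Integrals against the reproducing kernel -/

/-- The function `z ↦ ∫ H(w) K(z, w) dμ(w)`. -/
noncomputable def kernelIntegral (H : Cn n → ℂ) (z : Cn n) : ℂ :=
  ∫ w, H w * kernel z w ∂(gaussian n)

lemma SubGaussian.integrable_mul_kernel {H : Cn n → ℂ} (h : SubGaussian H) (z : Cn n) :
    Integrable (fun w => H w * kernel z w) (gaussian n) :=
  (h.mul_tame (tame_kernel z)).integrable

lemma SubGaussian.hasFDerivAt_kernelIntegral {H : Cn n → ℂ} (h : SubGaussian H) (z₀ : Cn n) :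
    Integrable (fun w => (H w * kernel z₀ w) • innerSL ℂ w) (gaussian n) ∧
    HasFDerivAt (kernelIntegral H)
      (∫ w, (H w * kernel z₀ w) • innerSL ℂ w ∂(gaussian n)) z₀ := by
  let F' : Cn n → Cn n → (Cn n →L[ℂ] ℂ) := fun z w => (H w * kernel z w) • innerSL ℂ w
  have hmeas : ∀ z, AEStronglyMeasurable (F' z) (gaussian n) := fun z =>
    (h.measurable.aestronglyMeasurable.mul (kernel_continuous z).aestronglyMeasurable).smul
      (innerSL ℂ).continuous.aestronglyMeasurable
  have hb : Integrable (fun w => ‖H w‖ * Real.exp ((‖z₀‖ + 2) * ‖w‖)) (gaussian n) := by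
    refine (h.mul_tame (tame_exp (‖z₀‖ + 2))).integrable.norm.congr (ae_of_all _ fun w => ?_)
    simp only [norm_mul, Complex.norm_real, Real.norm_eq_abs, Real.abs_exp]
  -- In `‖z₀‖ + 2`, one unit is the radius of the ball and the other absorbs the factor `‖w‖` from
  -- differentiating the kernel.
  have hle : ∀ w, ∀ z ∈ Metric.ball z₀ 1, ‖F' z w‖ ≤ ‖H w‖ * Real.exp ((‖z₀‖ + 2) * ‖w‖) := by
    intro w z hz
    simp only [F']
    rw [norm_smul, norm_mul, mul_assoc]
    refine mul_le_mul_of_nonneg_left ?_ (norm_nonneg _)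
    have hz' : ‖z‖ ≤ ‖z₀‖ + 1 := by
      have := norm_sub_norm_le z z₀
      rw [Metric.mem_ball, dist_eq_norm] at hz
      linarith
    rw [innerSL_apply_norm]
    have h1 : ‖w‖ ≤ Real.exp ‖w‖ := by linarith [Real.add_one_le_exp ‖w‖]
    calc ‖kernel z w‖ * ‖w‖ ≤ Real.exp (‖z‖ * ‖w‖) * Real.exp ‖w‖ :=
          mul_le_mul (norm_kernel_le z w) h1 (norm_nonneg _) (Real.exp_pos _).le
      _ = Real.exp (‖z‖ * ‖w‖ + ‖w‖) := (Real.exp_add _ _).symm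
      _ ≤ _ := Real.exp_le_exp.2 (by nlinarith [norm_nonneg w])
  refine ⟨hb.mono' (hmeas z₀) (ae_of_all _ fun w => hle w z₀ (Metric.mem_ball_self one_pos)), ?_⟩
  refine hasFDerivAt_integral_of_dominated_of_fderiv_le (𝕜 := ℂ)
    (F' := F') (bound := fun w => ‖H w‖ * Real.exp ((‖z₀‖ + 2) * ‖w‖))
    (Metric.ball_mem_nhds z₀ one_pos) ?_ ?_ (hmeas z₀) (ae_of_all _ hle) hb ?_
  · exact Eventually.of_forall fun z =>
      h.measurable.aestronglyMeasurable.mul (kernel_continuous z).aestronglyMeasurable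
  · exact h.integrable_mul_kernel z₀
  · refine ae_of_all _ fun w z _ => ?_
    have h1 : HasFDerivAt (fun z : Cn n => (inner ℂ w z : ℂ)) (innerSL ℂ w) z :=
      (innerSL ℂ w).hasFDerivAt
    simpa [F', kernel, smul_smul] using (h1.cexp).const_mul (H w)

lemma SubGaussian.differentiable_kernelIntegral {H : Cn n → ℂ} (h : SubGaussian H) :
    Differentiable ℂ (kernelIntegral H) := fun z =>
  (h.hasFDerivAt_kernelIntegral z).2.differentiableAt

/-- Differentiating `K(z,w) = exp(z · w̄)` in `z_j` multiplies it by `w̄_j`; thus derivatives become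
moments, without any Leibniz rule. -/
lemma SubGaussian.partialDeriv_kernelIntegral {H : Cn n → ℂ} (h : SubGaussian H) (j : Fin n) :
    partialDeriv j (kernelIntegral H) = kernelIntegral (fun w => H w * conj (w j)) := by
  funext z
  obtain ⟨hi, hd⟩ := h.hasFDerivAt_kernelIntegral z
  rw [partialDeriv, hd.fderiv, ContinuousLinearMap.integral_apply hi, kernelIntegral]
  refine integral_congr_ae (ae_of_all _ fun w => ?_)
  simp [PiLp.inner_apply]
  ring

lemma SubGaussian.iterate_partialDeriv_kernelIntegral {H : Cn n → ℂ} (h : SubGaussian H)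
    (j : Fin n) (m : ℕ) :
    SubGaussian (fun w => H w * conj (w j) ^ m) ∧
    (partialDeriv j)^[m] (kernelIntegral H) = kernelIntegral (fun w => H w * conj (w j) ^ m) := by
  induction m with
  | zero => simpa using h
  | succ m ih =>
    have e : (fun w => H w * conj (w j) ^ (m + 1)) =
        fun w : Cn n => H w * conj (w j) ^ m * conj (w j) := by
      funext w; ring
    refine ⟨?_, ?_⟩
    · rw [e]; exact ih.1.mul_tame (tame_conj_coord j)
    · rw [Function.iterate_succ_apply', ih.2, ih.1.partialDeriv_kernelIntegral, e]

/-- The conjugate monomial `w̄^i`. -/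
noncomputable def conjMonomial (i : Fin n → ℕ) (w : Cn n) : ℂ := ∏ k, conj (w k) ^ i k

lemma SubGaussian.mul_conjMonomial {H : Cn n → ℂ} (h : SubGaussian H) (i : Fin n → ℕ) :
    SubGaussian (fun w => H w * conjMonomial i w) ∧
    multiDeriv i (kernelIntegral H) = kernelIntegral (fun w => H w * conjMonomial i w) := by
  -- `multiDeriv` is a fold over the list of coordinates, so the induction runs over an arbitrary
  -- list.
  have key : ∀ L : List (Fin n),
      SubGaussian (fun w => H w * (L.map fun j => conj (w j) ^ i j).prod) ∧
      L.foldr (fun j φ => (partialDeriv j)^[i j] φ) (kernelIntegral H) =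
        kernelIntegral (fun w => H w * (L.map fun j => conj (w j) ^ i j).prod) := by
    intro L
    induction L with
    | nil => simpa using h
    | cons j L ih =>
      have e : (fun w => H w * ((j :: L).map fun j => conj (w j) ^ i j).prod) =
          fun w : Cn n => H w * (L.map fun j => conj (w j) ^ i j).prod * conj (w j) ^ i j := by
        funext w; simp only [List.map_cons, List.prod_cons]; ring
      have := ih.1.iterate_partialDeriv_kernelIntegral j (i j)
      rw [e, List.foldr_cons, ih.2]
      exact this
  have e : ∀ w : Cn n, conjMonomial i w = ((List.finRange n).map fun j => conj (w j) ^ i j).prod :=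
    fun w => by rw [conjMonomial, ← List.ofFn_eq_map, List.prod_ofFn]
  simp only [e]
  exact key _

/-- Translation by `z` turns `F(w) K(z,w) dμ(w)` into `G dμ` with `G` entire and `G(0) = F(z)`, and
the mean value property applies. Integrability replaces `F ∈ L²`, since products such as `f ·
T_{conj g} h` are not known to lie in `L²`. -/
lemma reproducing_of_integrable {F : Cn n → ℂ} (hF : Differentiable ℂ F) (z : Cn n)
    (hint : Integrable (fun w => F w * kernel z w) (gaussian n)) :
    ∫ w, F w * kernel z w ∂(gaussian n) = F z := by
  set ρ : Cn n → ℂ := fun w => (((Real.pi ^ n)⁻¹ * Real.exp (-‖w‖ ^ 2) : ℝ) : ℂ) with hρ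
  let G : Cn n → ℂ := fun w => F (w + z) * Complex.exp (-inner ℂ z w)
  have hlin : Differentiable ℂ (fun w : Cn n => (inner ℂ z w : ℂ)) :=
    (innerSL ℂ z).differentiable
  have hG : Differentiable ℂ G :=
    (hF.comp (differentiable_id.add_const z)).mul hlin.neg.cexp
  have key : ∀ w, ρ w * G w = (fun w => ρ w * (F w * kernel z w)) (w + z) := fun w => by
    simp only [G, hρ, kernel]
    -- Completing the square: expand `‖w + z‖²` as an inner product.
    have e1 : (((Real.exp (-‖w‖ ^ 2) : ℝ) : ℂ)) * Complex.exp (-inner ℂ z w) =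
        ((Real.exp (-‖w + z‖ ^ 2) : ℝ) : ℂ) * Complex.exp (inner ℂ (w + z) z) := by
      rw [Complex.ofReal_exp, Complex.ofReal_exp, ← Complex.exp_add, ← Complex.exp_add]
      congr 1
      have h1 : ((‖w‖ : ℂ)) ^ 2 = inner ℂ w w := (inner_self_eq_norm_sq_to_K w).symm
      have h2 : ((‖w + z‖ : ℂ)) ^ 2 = inner ℂ (w + z) (w + z) :=
        (inner_self_eq_norm_sq_to_K (w + z)).symm
      push_cast
      rw [h1, h2]
      simp only [inner_add_left, inner_add_right]
      ring
    push_cast at e1 ⊢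
    linear_combination ((Real.pi : ℂ) ^ n)⁻¹ * F (w + z) * e1
  have hGi : Integrable G (gaussian n) := by
    rw [integrable_gaussian_iff]
    refine Integrable.congr ((integrable_gaussian_iff.1 hint).comp_add_right z)
      (ae_of_all _ fun w => (key w).symm)
  have h := integral_entire hG hGi
  rw [integral_density, one_mul, integral_gaussian] at h
  change ∫ w, ρ w * G w = _ at h
  simp only [key] at h
  rw [integral_add_right_eq_self (fun w => ρ w * (F w * kernel z w)) z] at h
  rw [integral_gaussian]
  refine h.trans ?_
  simp [G]

lemma SubGaussian.kernelIntegral_eq {F : Cn n → ℂ} (h : SubGaussian F) (hF : Differentiable ℂ F) :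
    kernelIntegral F = F :=
  funext fun z => reproducing_of_integrable hF z (h.integrable_mul_kernel z)

lemma kernel_zero_left (w : Cn n) : kernel 0 w = 1 := by simp [kernel]

lemma SubGaussian.multiDeriv_zero {H : Cn n → ℂ} (h : SubGaussian H) (i : Fin n → ℕ) :
    multiDeriv i (kernelIntegral H) 0 = ∫ w, H w * conjMonomial i w ∂(gaussian n) := by
  rw [(h.mul_conjMonomial i).2, kernelIntegral]
  simp only [kernel_zero_left, mul_one]

lemma measurable_conjMonomial (i : Fin n → ℕ) : Measurable (conjMonomial (n := n) i) := by
  unfold conjMonomial; fun_prop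

/-! ### Expansion of the exponential in several variables -/

/-- Absolutely convergent series multiply; induction on the number of factors splits off the first
index. -/
lemma hasSum_prod_pi {f : Fin n → ℕ → ℂ} {a : Fin n → ℂ} (hs : ∀ k, Summable fun m => ‖f k m‖)
    (hf : ∀ k, HasSum (f k) (a k)) :
    HasSum (fun i : Fin n → ℕ => ∏ k, f k (i k)) (∏ k, a k) ∧
      Summable fun i : Fin n → ℕ => ‖∏ k, f k (i k)‖ := by
  induction n with
  | zero =>
    simp only [Finset.univ_eq_empty, Finset.prod_empty]
    exact ⟨by simp [hasSum_unique], Summable.of_finite⟩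
  | succ n ih =>
    obtain ⟨h1, h2⟩ := ih (f := fun k => f k.succ) (a := fun k => a k.succ)
      (fun k => hs k.succ) (fun k => hf k.succ)
    have hn := (hs 0).mul_norm h2
    have hm := (hf 0).mul h1 hn.of_norm
    have e : ∀ p : ℕ × (Fin n → ℕ), f 0 p.1 * ∏ k, f k.succ (p.2 k) =
        (fun i : Fin (n + 1) → ℕ => ∏ k, f k (i k)) (Fin.consEquiv (fun _ => ℕ) p) := fun p => by
      simp [Fin.prod_univ_succ, Fin.consEquiv]
    rw [Fin.prod_univ_succ a]
    constructor
    · rw [← (Fin.consEquiv (fun _ : Fin (n + 1) => ℕ)).hasSum_iff]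
      exact hm.congr_fun (fun p => (e p).symm)
    · rw [← (Fin.consEquiv (fun _ : Fin (n + 1) => ℕ)).summable_iff]
      exact hn.congr fun p => by rw [e p]; rfl

lemma hasSum_exp_pi (a : Fin n → ℂ) :
    HasSum (fun i : Fin n → ℕ => (∏ k, a k ^ i k) / ((∏ k, (i k).factorial : ℕ) : ℂ))
      (Complex.exp (∑ k, a k)) ∧
    HasSum (fun i : Fin n → ℕ => ‖(∏ k, a k ^ i k) / ((∏ k, (i k).factorial : ℕ) : ℂ)‖)
      (Real.exp (∑ k, ‖a k‖)) := by
  have key : ∀ a : Fin n → ℂ,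
      HasSum (fun i : Fin n → ℕ => (∏ k, a k ^ i k) / ((∏ k, (i k).factorial : ℕ) : ℂ))
      (Complex.exp (∑ k, a k)) := fun a => by
    have := (hasSum_prod_pi (f := fun k m => a k ^ m / (m.factorial : ℂ))
      (a := fun k => Complex.exp (a k))
      (fun k => NormedSpace.norm_expSeries_div_summable (a k))
      (fun k => by
        rw [Complex.exp_eq_exp_ℂ]
        exact NormedSpace.expSeries_div_hasSum_exp (a k))).1
    simpa only [Finset.prod_div_distrib, Complex.exp_sum, Nat.cast_prod] using this
  refine ⟨key a, ?_⟩
  -- The norms of the terms are the terms of the same series at the point `(‖a k‖)`.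
  have h := Complex.hasSum_re (key fun k => (‖a k‖ : ℂ))
  have e : Complex.exp (∑ k, (‖a k‖ : ℂ)) = ((Real.exp (∑ k, ‖a k‖) : ℝ) : ℂ) := by push_cast; rfl
  rw [e, Complex.ofReal_re] at h
  refine h.congr_fun fun i => ?_
  rw [norm_div, norm_prod, Complex.norm_natCast]
  simp only [norm_pow]
  rw [← Complex.ofReal_re ((∏ k, ‖a k‖ ^ i k) / ((∏ k, (i k).factorial : ℕ) : ℝ))]
  push_cast; rfl

/-! ### Coordinatewise conjugation -/

/-- Coordinatewise conjugation `w ↦ w̄` on `ℂⁿ`. -/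
noncomputable def conjVec : Cn n ≃ₗᵢ[ℝ] Cn n :=
  LinearIsometryEquiv.piLpCongrRight 2 (fun _ => Complex.conjLIE)

lemma conjVec_apply (w : Cn n) (j : Fin n) : conjVec w j = conj (w j) := by
  simp [conjVec]

lemma starFn_apply (g : Cn n → ℂ) (z : Cn n) : starFn g z = conj (g (conjVec z)) := by
  simp [starFn, conjVec, LinearIsometryEquiv.piLpCongrRight_apply]

lemma kernel_conjVec (z w : Cn n) : kernel (conjVec z) (conjVec w) = conj (kernel z w) := by
  rw [kernel_eq, kernel_eq, ← Complex.exp_conj, map_sum]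
  simp [conjVec_apply]

lemma integral_comp_conjVec (G : Cn n → ℂ) :
    ∫ w, G (conjVec w) ∂(gaussian n) = ∫ w, G w ∂(gaussian n) := by
  rw [integral_gaussian, integral_gaussian]
  have h := (conjVec (n := n)).measurePreserving.integral_comp
    (conjVec (n := n)).toHomeomorph.measurableEmbedding
    (fun w => (((Real.pi ^ n)⁻¹ * Real.exp (-‖w‖ ^ 2) : ℝ) : ℂ) * G w)
  simpa only [LinearIsometryEquiv.norm_map] using h

lemma Tame.starFn {g : Cn n → ℂ} (h : Tame g) : Tame (starFn g) := by
  have e : Fock.starFn g = fun z => conj (g (conjVec z)) := funext (starFn_apply g)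
  rw [e]
  refine ⟨Complex.continuous_conj.measurable.comp
    (h.measurable.comp (conjVec (n := n)).continuous.measurable), fun ε hε => ?_⟩
  obtain ⟨C, hC, hg⟩ := h.growth ε hε
  exact ⟨C, hC, fun w => by simpa using hg (conjVec w)⟩

/-- The measure is invariant under `w ↦ w̄` and the kernel is conjugated by it, so the reproducing
formula for `g` transfers to `g*`; holomorphy of `g*` need not be checked. -/
lemma kernelIntegral_starFn {g : Cn n → ℂ} (h : Tame g) (hd : Differentiable ℂ g) :
    kernelIntegral (starFn g) = starFn g := by
  funext z
  rw [starFn_apply, ← congrFun (h.subGaussian.kernelIntegral_eq hd) (conjVec z), kernelIntegral,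
    kernelIntegral, ← integral_conj,
    ← integral_comp_conjVec (fun w => conj (g w * kernel (conjVec z) w))]
  refine integral_congr_ae (ae_of_all _ fun w => ?_)
  simp only [starFn_apply, map_mul, kernel_conjVec, Complex.conj_conj]

/-! ### The pairing of two entire functions -/

/-- Both sums are the exponential series in the products `w̄_k v̄_k`. The bound uses `2ab ≤ a² + b²`
and puts only `1/2` on each variable, which leaves room below `1` for other factors. -/
lemma hasSum_conjMonomial_mul (w v : Cn n) :
    HasSum (fun i : Fin n → ℕ =>
      conjMonomial i w * conjMonomial i v / ((∏ k, (i k).factorial : ℕ) : ℂ))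
      (kernel (conjVec w) v) ∧
    ∃ E : ℝ, E ≤ Real.exp (1 / 2 * ‖w‖ ^ 2 + 1 / 2 * ‖v‖ ^ 2) ∧ HasSum (fun i : Fin n → ℕ =>
      ‖conjMonomial i w * conjMonomial i v / ((∏ k, (i k).factorial : ℕ) : ℂ)‖) E := by
  have h := hasSum_exp_pi (fun k => conj (w k) * conj (v k))
  have e : ∀ i : Fin n → ℕ, conjMonomial i w * conjMonomial i v =
      ∏ k, (conj (w k) * conj (v k)) ^ i k := fun i => by
    simp only [conjMonomial, ← Finset.prod_mul_distrib, mul_pow]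
  simp only [e]
  rw [kernel_eq]
  simp only [conjVec_apply]
  refine ⟨h.1, _, ?_, h.2⟩
  refine Real.exp_le_exp.2 ?_
  rw [EuclideanSpace.norm_sq_eq, EuclideanSpace.norm_sq_eq, Finset.mul_sum, Finset.mul_sum,
    ← Finset.sum_add_distrib]
  refine Finset.sum_le_sum fun k _ => ?_
  rw [norm_mul, RCLike.norm_conj, RCLike.norm_conj]
  nlinarith [sq_nonneg (‖w k‖ - ‖v k‖)]

lemma measurable_kernel {α : Type*} [MeasurableSpace α] {u v : α → Cn n} (hu : Measurable u)
    (hv : Measurable v) : Measurable (fun x => kernel (u x) (v x)) := by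
  unfold kernel; fun_prop

/-- `∑ᵢ cᵢ ∂ⁱF(0) = ∫ conj(g) F dμ`, where `cᵢ` are the Taylor coefficients of `g*`. -/
lemma hasSum_pairing {g F : Cn n → ℂ} (hg : Tame g) (hgd : Differentiable ℂ g) (hF : Tame F)
    (hFd : Differentiable ℂ F) :
    HasSum (fun i => coeff (starFn g) i * multiDeriv i F 0)
      (∫ t, conj (g t) * F t ∂(gaussian n)) := by
  set G := starFn g with hG
  have hGt : Tame G := hg.starFn
  -- The Taylor coefficient of `g*` and the derivative of `F` are both moments, so each term of the
  -- series is a double integral.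
  let Φ : (Fin n → ℕ) → Cn n × Cn n → ℂ := fun i p => G p.1 * F p.2 *
    (conjMonomial i p.1 * conjMonomial i p.2 / ((∏ k, (i k).factorial : ℕ) : ℂ))
  have hterm : ∀ i, coeff G i * multiDeriv i F 0 =
      ∫ p, Φ i p ∂((gaussian n).prod (gaussian n)) := fun i => by
    have e1 := hGt.subGaussian.multiDeriv_zero i
    have e2 := hF.subGaussian.multiDeriv_zero i
    rw [kernelIntegral_starFn hg hgd] at e1
    rw [hF.subGaussian.kernelIntegral_eq hFd] at e2
    rw [coeff, e1, e2, div_mul_eq_mul_div, ← integral_prod_mul, ← integral_div]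
    refine integral_congr_ae (ae_of_all _ fun p => ?_)
    simp only [Φ]
    ring
  have hm : ∀ i, Measurable (Φ i) := fun i =>
    ((hGt.measurable.comp measurable_fst).mul (hF.measurable.comp measurable_snd)).mul
      ((((measurable_conjMonomial i).comp measurable_fst).mul
        ((measurable_conjMonomial i).comp measurable_snd)).div_const _)
  -- With the `1/2` from the exponential series, `1/4 + 1/2 = 3/4 < 1` in each variable.
  obtain ⟨C, hC, hCG⟩ := hGt.growth (1 / 4) (by norm_num)
  obtain ⟨D, hD, hDF⟩ := hF.growth (1 / 4) (by norm_num)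
  have hGF : ∀ p : Cn n × Cn n, ‖G p.1 * F p.2‖ ≤
      C * D * Real.exp (1 / 4 * ‖p.1‖ ^ 2 + 1 / 4 * ‖p.2‖ ^ 2) := fun p => by
    rw [norm_mul, Real.exp_add, mul_mul_mul_comm]
    exact mul_le_mul (hCG _) (hDF _) (norm_nonneg _) (by positivity)
  have hsum : ∀ p, Summable fun i => ‖Φ i p‖ := fun p => by
    obtain ⟨_, E, _, h⟩ := hasSum_conjMonomial_mul p.1 p.2
    simpa only [Φ, norm_mul] using (h.summable.mul_left ‖G p.1 * F p.2‖)
  have hle : ∀ p, ∑' i, ‖Φ i p‖ ≤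
      C * D * Real.exp (3 / 4 * ‖p.1‖ ^ 2 + 3 / 4 * ‖p.2‖ ^ 2) := fun p => by
    obtain ⟨_, E, hE, h⟩ := hasSum_conjMonomial_mul p.1 p.2
    have e : ∑' i, ‖Φ i p‖ = ‖G p.1 * F p.2‖ * E := by
      rw [← h.tsum_eq, ← tsum_mul_left]
      simp only [Φ, norm_mul]
    rw [e]
    have e2 : Real.exp (3 / 4 * ‖p.1‖ ^ 2 + 3 / 4 * ‖p.2‖ ^ 2) =
        Real.exp (1 / 4 * ‖p.1‖ ^ 2 + 1 / 4 * ‖p.2‖ ^ 2) *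
        Real.exp (1 / 2 * ‖p.1‖ ^ 2 + 1 / 2 * ‖p.2‖ ^ 2) := by
      rw [← Real.exp_add]; congr 1; ring
    rw [e2, ← mul_assoc]
    refine (mul_le_mul_of_nonneg_left hE (norm_nonneg _)).trans ?_
    exact mul_le_mul_of_nonneg_right (hGF p) (Real.exp_pos _).le
  have hlim : ∀ p, HasSum (fun i => Φ i p) (G p.1 * F p.2 * kernel (conjVec p.1) p.2) := fun p =>
    (hasSum_conjMonomial_mul p.1 p.2).1.mul_left _
  have hlimm : Measurable fun p : Cn n × Cn n => G p.1 * F p.2 * kernel (conjVec p.1) p.2 :=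
    ((hGt.measurable.comp measurable_fst).mul (hF.measurable.comp measurable_snd)).mul
      (measurable_kernel ((conjVec (n := n)).continuous.measurable.comp measurable_fst)
        measurable_snd)
  have hlimi : Integrable (fun p : Cn n × Cn n => G p.1 * F p.2 * kernel (conjVec p.1) p.2)
      ((gaussian n).prod (gaussian n)) := by
    refine integrable_prod_of_le hlimm (a := 3 / 4) (b := 3 / 4) (C := C * D) (by norm_num)
      (by norm_num) fun p => ?_
    rw [← (hlim p).tsum_eq]
    exact (norm_tsum_le_tsum_norm (hsum p)).trans (hle p)
  have hbi : Integrable (fun p => ∑' i, ‖Φ i p‖) ((gaussian n).prod (gaussian n)) := by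
    have hmeas : Measurable fun p : Cn n × Cn n => ∑' i, ‖Φ i p‖ :=
      Measurable.tsum fun i => (hm i).norm
    have hn : ∀ p, ‖((∑' i, ‖Φ i p‖ : ℝ) : ℂ)‖ = ∑' i, ‖Φ i p‖ := fun p => by
      rw [Complex.norm_real, Real.norm_of_nonneg (tsum_nonneg fun i => norm_nonneg _)]
    have hint := integrable_prod_of_le (Φ := fun p => ((∑' i, ‖Φ i p‖ : ℝ) : ℂ))
      (Complex.measurable_ofReal.comp hmeas) (a := 3 / 4) (b := 3 / 4) (C := C * D) (by norm_num)
      (by norm_num) fun p => (hn p).trans_le (hle p)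
    exact hint.norm.congr (ae_of_all _ hn)
  have h := hasSum_integral_of_dominated_convergence (μ := (gaussian n).prod (gaussian n))
    (F := Φ) (fun i p => ‖Φ i p‖) (fun i => (hm i).aestronglyMeasurable)
    (fun i => ae_of_all _ fun p => le_rfl) (ae_of_all _ hsum) hbi (ae_of_all _ hlim)
  -- The inner integral reproduces `F(w̄)`, and the substitution `w ↦ w̄` turns `g*(w)` into
  -- `conj(g)`.
  have hval : ∫ p, G p.1 * F p.2 * kernel (conjVec p.1) p.2 ∂((gaussian n).prod (gaussian n)) =
      ∫ t, conj (g t) * F t ∂(gaussian n) := by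
    rw [integral_prod _ hlimi, ← integral_comp_conjVec (fun t => conj (g t) * F t)]
    refine integral_congr_ae (ae_of_all _ fun w => ?_)
    have hw := congrFun (hF.subGaussian.kernelIntegral_eq hFd) (conjVec w)
    simp only [mul_assoc]
    rw [integral_const_mul, ← hw, hG, starFn_apply]
    rfl
  rw [hval] at h
  exact h.congr_fun hterm

/-! ### Dilations -/

lemma iterate_partialDeriv_comp_smul (r : ℂ) (j : Fin n) (m : ℕ) (a : ℂ) (F : Cn n → ℂ) :
    (partialDeriv j)^[m] (fun z => a * F (r • z)) =
      fun z => a * r ^ m * (partialDeriv j)^[m] F (r • z) := by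
  induction m with
  | zero => simp
  | succ m ih =>
    rw [Function.iterate_succ_apply', ih, Function.iterate_succ_apply']
    funext z
    set H := (partialDeriv j)^[m] F
    have e : (fun z => a * r ^ m * H (r • z)) = (a * r ^ m) • fun z => H (r • z) := by
      funext z; simp
    rw [partialDeriv, e, fderiv_const_smul_field, Pi.smul_apply, fderiv_comp_smul]
    simp [partialDeriv]
    ring

lemma multiDeriv_comp_smul (r : ℂ) (i : Fin n → ℕ) (F : Cn n → ℂ) (z : Cn n) :
    multiDeriv i (fun z => F (r • z)) z = r ^ (∑ k, i k) * multiDeriv i F (r • z) := by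
  have key : ∀ L : List (Fin n),
      L.foldr (fun j φ => (partialDeriv j)^[i j] φ) (fun z => F (r • z)) =
        fun z => r ^ (L.map i).sum * L.foldr (fun j φ => (partialDeriv j)^[i j] φ) F (r • z) := by
    intro L
    induction L with
    | nil => simp
    | cons j L ih =>
      simp only [List.foldr_cons, ih, iterate_partialDeriv_comp_smul, List.map_cons, List.sum_cons]
      funext z
      ring
  rw [multiDeriv, key, ← List.ofFn_eq_map, List.sum_ofFn]
  rfl

lemma Tame.comp_smul {F : Cn n → ℂ} (h : Tame F) {r : ℝ} (hr : 0 < r) :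
    Tame (fun z => F ((r : ℂ) • z)) := by
  refine ⟨h.measurable.comp (measurable_const_smul _), fun ε hε => ?_⟩
  obtain ⟨C, hC, hF⟩ := h.growth (ε / r ^ 2) (by positivity)
  refine ⟨C, hC, fun w => (hF _).trans_eq ?_⟩
  rw [norm_smul, Complex.norm_real, Real.norm_of_nonneg hr.le]
  congr 2
  field_simp

lemma starFn_comp_smul (g : Cn n → ℂ) (r : ℝ) :
    starFn (fun z => g ((r : ℂ) • z)) = fun z => starFn g ((r : ℂ) • z) := by
  funext z
  simp only [starFn]
  congr 2
  ext j
  simp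

/-- The pairing is invariant under opposite dilations of its arguments. -/
lemma hasSum_pairing_dilate {g F : Cn n → ℂ} (hg : Tame g) (hgd : Differentiable ℂ g)
    (hF : Tame F) (hFd : Differentiable ℂ F) {r : ℝ} (hr : 0 < r) :
    HasSum (fun i => coeff (starFn g) i * multiDeriv i F 0)
      (∫ t, conj (g (((r⁻¹ : ℝ) : ℂ) • t)) * F ((r : ℂ) • t) ∂(gaussian n)) := by
  have hsmul : ∀ a : ℂ, Differentiable ℂ (fun z : Cn n => a • z) := fun a =>
    differentiable_id.const_smul a
  have h := hasSum_pairing (hg.comp_smul (inv_pos.2 hr)) (hgd.comp (hsmul _))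
    (hF.comp_smul hr) (hFd.comp (hsmul r))
  -- The factors `r^{-|i|}` from `g*` and `r^{|i|}` from `F` cancel term by term.
  refine h.congr_fun fun i => ?_
  rw [multiDeriv_comp_smul, starFn_comp_smul, coeff, coeff, multiDeriv_comp_smul]
  simp only [smul_zero]
  have : (r : ℂ) ≠ 0 := by exact_mod_cast hr.ne'
  rw [Complex.ofReal_inv, inv_pow]
  field_simp

/-! ### The symbol of the product -/

/-- Substitute `w = z - t`: the exponent `-|z-t|² + z · conj(z-t)` equals `-|t|² + t · z̄`. -/
lemma integral_mul_kernel_translate (A : Cn n → ℂ) (z : Cn n) :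
    ∫ w, A w * kernel z w ∂(gaussian n) = ∫ t, A (z - t) * kernel t z ∂(gaussian n) := by
  rw [integral_gaussian, integral_gaussian, ← integral_sub_left_eq_self _ _ z]
  refine integral_congr_ae (ae_of_all _ fun t => ?_)
  have e1 : (((Real.exp (-‖z - t‖ ^ 2) : ℝ) : ℂ)) * kernel z (z - t) =
      ((Real.exp (-‖t‖ ^ 2) : ℝ) : ℂ) * kernel t z := by
    rw [kernel, kernel, Complex.ofReal_exp, Complex.ofReal_exp, ← Complex.exp_add,
      ← Complex.exp_add]
    congr 1
    have h1 : ((‖t‖ : ℂ)) ^ 2 = inner ℂ t t := (inner_self_eq_norm_sq_to_K t).symm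
    have h2 : ((‖z - t‖ : ℂ)) ^ 2 = inner ℂ (z - t) (z - t) :=
      (inner_self_eq_norm_sq_to_K (z - t)).symm
    push_cast
    rw [h1, h2]
    simp only [inner_sub_left, inner_sub_right]
    ring
  simp only
  push_cast at e1 ⊢
  linear_combination ((Real.pi : ℂ) ^ n)⁻¹ * A (z - t) * e1

lemma norm_sub_sq_le (z t : Cn n) : ‖z - t‖ ^ 2 ≤ 2 * ‖z‖ ^ 2 + 2 * ‖t‖ ^ 2 := by
  have h : ‖z - t‖ ≤ ‖z‖ + ‖t‖ := norm_sub_le _ _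
  nlinarith [norm_nonneg (z - t), sq_nonneg (‖z‖ - ‖t‖)]

lemma Tame.comp_sub {f : Cn n → ℂ} (h : Tame f) (z : Cn n) : Tame (fun t => f (z - t)) := by
  refine ⟨h.measurable.comp (measurable_const.sub measurable_id), fun ε hε => ?_⟩
  obtain ⟨C, hC, hf⟩ := h.growth (ε / 2) (by positivity)
  refine ⟨C * Real.exp (ε * ‖z‖ ^ 2), by positivity, fun t => (hf _).trans ?_⟩
  rw [mul_assoc, ← Real.exp_add]
  refine mul_le_mul_of_nonneg_left (Real.exp_le_exp.2 ?_) hC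
  nlinarith [norm_sub_sq_le z t]

lemma differentiable_kernel_left (z : Cn n) : Differentiable ℂ (fun t => kernel t z) :=
  (innerSL ℂ z).differentiable.cexp

lemma tame_kernel_left (z : Cn n) : Tame (fun t => kernel t z) :=
  ⟨(differentiable_kernel_left z).continuous.measurable, fun _ hε =>
    growthBound_of_norm_le_exp (a := ‖z‖) (fun w => by
      rw [mul_comm]; exact norm_kernel_le w z) hε⟩

/-- The function `t ↦ exp(t · z̄) f(z - t)`, whose Taylor coefficients at the origin are given by
`(z̄ - ∂_z)^i f(z)`. -/
noncomputable def shifted (f : Cn n → ℂ) (z : Cn n) : Cn n → ℂ := fun t => f (z - t) * kernel t z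

lemma Tame.shifted {f : Cn n → ℂ} (h : Tame f) (z : Cn n) : Tame (shifted f z) :=
  (h.comp_sub z).mul (tame_kernel_left z)

lemma differentiable_shifted {f : Cn n → ℂ} (h : Differentiable ℂ f) (z : Cn n) :
    Differentiable ℂ (shifted f z) :=
  (h.comp (differentiable_id.const_sub z)).mul (differentiable_kernel_left z)

/-- The binomial theorem in each coordinate, with signs and coefficients arranged as in
`conjSubDeriv`. -/
lemma conjMonomial_sub (i : Fin n → ℕ) (z w : Cn n) :
    conjMonomial i (z - w) = ∑ l ∈ Finset.Iic i, ((∏ k, (i k).choose (l k) : ℕ) : ℂ) *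
      (∏ k, conj (z k) ^ l k) * ((-1) ^ (∑ k, (i k - l k)) * conjMonomial (i - l) w) := by
  have e : Finset.Iic i = Fintype.piFinset fun k => Finset.range (i k + 1) := by
    ext l
    simp [Pi.le_def]
  rw [e, conjMonomial]
  have h : ∀ k, conj ((z - w) k) ^ i k = ∑ m ∈ Finset.range (i k + 1),
      conj (z k) ^ m * (-conj (w k)) ^ (i k - m) * ((i k).choose m : ℂ) := fun k => by
    rw [← add_pow]; simp [sub_eq_add_neg]
  simp only [h]
  rw [Finset.prod_univ_sum]
  refine Finset.sum_congr rfl fun l _ => ?_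
  simp only [conjMonomial, Finset.prod_mul_distrib, Pi.sub_apply, Nat.cast_prod]
  have h2 : ∏ k, (-conj (w k)) ^ (i k - l k) =
      (-1) ^ (∑ k, (i k - l k)) * ∏ k, conj (w k) ^ (i k - l k) := by
    rw [← Finset.prod_pow_eq_pow_sum, ← Finset.prod_mul_distrib]
    exact Finset.prod_congr rfl fun k _ => neg_pow _ _
  rw [h2]
  ring

/-- The derivatives `∂^m f(z)` are integrals of `f(w) w̄^m K(z,w)`, so the binomial sum collects
into the integral of `f(w) conj(z-w)^i K(z,w)`. The substitution `w = z - t` makes this the `i`-th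
moment of `shifted f z`, its derivative at `0`. -/
lemma conjSubDeriv_eq {f : Cn n → ℂ} (hf : Tame f) (hfd : Differentiable ℂ f) (i : Fin n → ℕ)
    (z : Cn n) : conjSubDeriv i f z = multiDeriv i (shifted f z) 0 := by
  have e1 := (hf.shifted z).subGaussian.multiDeriv_zero i
  rw [(hf.shifted z).subGaussian.kernelIntegral_eq (differentiable_shifted hfd z)] at e1
  have e2 : ∀ m, multiDeriv m f z = ∫ w, f w * conjMonomial m w * kernel z w ∂(gaussian n) :=
    fun m => by
      have := (hf.subGaussian.mul_conjMonomial m).2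
      rw [hf.subGaussian.kernelIntegral_eq hfd] at this
      rw [this, kernelIntegral]
  have e3 : ∫ w, shifted f z w * conjMonomial i w ∂(gaussian n) =
      ∫ t, (fun w => f w * conjMonomial i (z - w)) (z - t) * kernel t z ∂(gaussian n) := by
    refine integral_congr_ae (ae_of_all _ fun w => ?_)
    simp only [shifted, sub_sub_cancel]
    ring
  rw [e1, e3, ← integral_mul_kernel_translate (fun w => f w * conjMonomial i (z - w)), conjSubDeriv]
  simp only [e2, ← integral_const_mul]
  rw [← integral_finsetSum]
  · refine integral_congr_ae (ae_of_all _ fun w => ?_)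
    simp only [conjMonomial_sub, Finset.mul_sum, Finset.sum_mul]
    exact Finset.sum_congr rfl fun l _ => by ring
  · intro l _
    exact (((hf.subGaussian.mul_conjMonomial (i - l)).1.integrable_mul_kernel z).const_mul
      _).const_mul _

lemma hasSum_opTerm {f g : Cn n → ℂ} (hf : Tame f) (hfd : Differentiable ℂ f) (hg : Tame g)
    (hgd : Differentiable ℂ g) (z : Cn n) {r : ℝ} (hr : 0 < r) :
    HasSum (opTerm (starFn g) f z)
      (∫ t, conj (g (((r⁻¹ : ℝ) : ℂ) • t)) * shifted f z ((r : ℂ) • t) ∂(gaussian n)) := by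
  have h := hasSum_pairing_dilate hg hgd (hf.shifted z) (differentiable_shifted hfd z) hr
  refine h.congr_fun fun i => ?_
  rw [opTerm, conjSubDeriv_eq hf hfd]

lemma prodSymbol_eq_integral_dilate {f g : Cn n → ℂ} (hf : Tame f) (hfd : Differentiable ℂ f)
    (hg : Tame g) (hgd : Differentiable ℂ g) (z : Cn n) {r : ℝ} (hr : 0 < r) :
    prodSymbol f g z =
      ∫ t, conj (g (((r⁻¹ : ℝ) : ℂ) • t)) * shifted f z ((r : ℂ) • t) ∂(gaussian n) :=
  (hasSum_opTerm hf hfd hg hgd z hr).tsum_eq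

lemma prodSymbol_eq_integral {f g : Cn n → ℂ} (hf : Tame f) (hfd : Differentiable ℂ f)
    (hg : Tame g) (hgd : Differentiable ℂ g) (z : Cn n) :
    prodSymbol f g z = ∫ t, conj (g t) * shifted f z t ∂(gaussian n) := by
  simpa using prodSymbol_eq_integral_dilate hf hfd hg hgd z one_pos

/-- Without dilation, the factor `exp(|t||z|)` would cost a fixed multiple of `|z|²`. Dilating by a
small `r` reduces it to `exp(r|t||z|)`, while `g(t/r)` remains tame. -/
lemma tame_prodSymbol {f g : Cn n → ℂ} (hf : Tame f) (hfd : Differentiable ℂ f)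
    (hg : Tame g) (hgd : Differentiable ℂ g) : Tame (prodSymbol f g) := by
  refine ⟨?_, fun ε hε => ?_⟩
  · rw [funext (prodSymbol_eq_integral hf hfd hg hgd)]
    refine (StronglyMeasurable.integral_prod_right (Measurable.stronglyMeasurable ?_)).measurable
    exact (Complex.continuous_conj.measurable.comp (hg.measurable.comp measurable_snd)).mul
      ((hf.measurable.comp (measurable_fst.sub measurable_snd)).mul
        (measurable_kernel measurable_snd measurable_fst))
  -- The cap `c ≤ 1` keeps the coefficient `1/2 + c²/4` of `‖t‖²` found below at most `3/4`.
  · suffices ∀ c : ℝ, 0 < c → c ≤ 1 → GrowthBound c (prodSymbol f g) from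
      (this (min ε 1) (by positivity) (min_le_right _ _)).mono (min_le_left _ _)
    intro c hc hc1
    -- With `r² = c/2`, the cross term `r‖t‖‖z‖` is at most `‖t‖²/4 + (c/2)‖z‖²`; the factor from
    -- `f` supplies the other `(c/2)‖z‖²`.
    set r := Real.sqrt (c / 2) with hr
    have hr0 : 0 < r := Real.sqrt_pos.2 (by positivity)
    have hr2 : r ^ 2 = c / 2 := Real.sq_sqrt (by positivity)
    obtain ⟨C, hC, hCf⟩ := hf.growth (c / 4) (by positivity)
    obtain ⟨D, hD, hDg⟩ := (hg.comp_smul (inv_pos.2 hr0)).growth (1 / 4) (by norm_num)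
    refine ⟨∫ t : Cn n, D * C * Real.exp (3 / 4 * ‖t‖ ^ 2) ∂(gaussian n),
      integral_nonneg fun t => by positivity, fun z => ?_⟩
    rw [prodSymbol_eq_integral_dilate hf hfd hg hgd z hr0, ← integral_mul_const]
    refine norm_integral_le_of_norm_le
      (((integrable_exp_sq (by norm_num)).const_mul _).mul_const _) (ae_of_all _ fun t => ?_)
    have h1 := hDg t
    have h2 := hCf (z - (r : ℂ) • t)
    have h3 := norm_kernel_le ((r : ℂ) • t) z
    have hrt : ‖(r : ℂ) • t‖ = r * ‖t‖ := by
      rw [norm_smul, Complex.norm_real, Real.norm_of_nonneg hr0.le]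
    have h4 := norm_sub_sq_le z ((r : ℂ) • t)
    rw [hrt] at h3 h4
    rw [norm_mul, RCLike.norm_conj, shifted, norm_mul]
    calc _ ≤ (D * Real.exp (1 / 4 * ‖t‖ ^ 2)) *
          (C * Real.exp (c / 4 * ‖z - (r : ℂ) • t‖ ^ 2) * Real.exp (r * ‖t‖ * ‖z‖)) := by
          gcongr
      _ = D * C * Real.exp (1 / 4 * ‖t‖ ^ 2 + c / 4 * ‖z - (r : ℂ) • t‖ ^ 2 +
          r * ‖t‖ * ‖z‖) := by
          rw [Real.exp_add, Real.exp_add]; ring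
      _ ≤ D * C * Real.exp (3 / 4 * ‖t‖ ^ 2 + c * ‖z‖ ^ 2) := by
          refine mul_le_mul_of_nonneg_left (Real.exp_le_exp.2 ?_) (by positivity)
          have h5 := mul_le_weighted (r * ‖t‖) ‖z‖ (half_pos hc)
          have h6 : (r * ‖t‖) ^ 2 / (4 * (c / 2)) = 1 / 4 * ‖t‖ ^ 2 := by
            rw [mul_pow, hr2]; field_simp
          have h7 : (r * ‖t‖) ^ 2 = c / 2 * ‖t‖ ^ 2 := by rw [mul_pow, hr2]
          have h8 : c ^ 2 * ‖t‖ ^ 2 ≤ 1 * ‖t‖ ^ 2 := by gcongr; nlinarith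
          rw [h7] at h4
          have h9 := mul_le_mul_of_nonneg_left h4 (show 0 ≤ c / 4 by positivity)
          rw [h6] at h5
          nlinarith
      _ = _ := by rw [Real.exp_add]; ring

/-! ### Pointwise bounds for functions in the Fock space -/

lemma conj_kernel (z w : Cn n) : conj (kernel z w) = kernel w z := by
  rw [kernel, kernel, ← Complex.exp_conj, inner_conj_symm]

lemma kernel_add_left (z t w : Cn n) : kernel (z + t) w = kernel z w * kernel t w := by
  rw [kernel, inner_add_right, Complex.exp_add, kernel, kernel]

lemma norm_kernel_self (z : Cn n) : ‖kernel z z‖ = Real.exp (‖z‖ ^ 2) := by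
  rw [kernel, inner_self_eq_norm_sq_to_K, Complex.norm_exp]
  norm_cast

/-- The kernel function `w ↦ K(w, z)` as an element of `L²`. -/
noncomputable def kernelVec (z : Cn n) : Lp ℂ 2 (gaussian n) :=
  ((memLp_kernel z).star).toLp (fun w => star (kernel z w))

lemma kernelVec_ae (z : Cn n) : kernelVec z =ᵐ[gaussian n] fun w => kernel w z := by
  filter_upwards [((memLp_kernel z).star).coeFn_toLp] with w hw
  exact hw.trans (conj_kernel z w)

lemma inner_kernelVec (z : Cn n) (u : Lp ℂ 2 (gaussian n)) :
    inner ℂ (kernelVec z) u = kernelIntegral u z := by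
  rw [L2.inner_def]
  refine integral_congr_ae ?_
  filter_upwards [kernelVec_ae z] with w hw
  rw [RCLike.inner_apply, hw, conj_kernel]

lemma kernelIntegral_congr {H K : Cn n → ℂ} (h : H =ᵐ[gaussian n] K) :
    kernelIntegral H = kernelIntegral K := by
  funext z
  refine integral_congr_ae ?_
  filter_upwards [h] with w hw
  rw [hw]

lemma kernelIntegral_kernel (z : Cn n) :
    kernelIntegral (fun w => kernel w z) = fun w => kernel w z :=
  (tame_kernel_left z).subGaussian.kernelIntegral_eq (differentiable_kernel_left z)

/-- The squared norm is `K(z,z)` by the reproducing property of the kernel function itself. -/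
lemma norm_kernelVec (z : Cn n) : ‖kernelVec z‖ = Real.exp (1 / 2 * ‖z‖ ^ 2) := by
  have h : ‖(inner ℂ (kernelVec z) (kernelVec z) : ℂ)‖ = Real.exp (‖z‖ ^ 2) := by
    rw [inner_kernelVec, kernelIntegral_congr (kernelVec_ae z), kernelIntegral_kernel,
      norm_kernel_self]
  rw [inner_self_eq_norm_sq_to_K, norm_pow, RCLike.norm_ofReal, abs_norm] at h
  rw [← abs_of_nonneg (norm_nonneg (kernelVec z)), ← Real.sqrt_sq_eq_abs, h,
    Real.sqrt_eq_iff_mul_self_eq (by positivity) (by positivity), ← Real.exp_add]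
  congr 1; ring

/-- Cauchy–Schwarz against the kernel function at `z`. From here on, membership in `F²` is used only
through this growth in the integral identities. -/
lemma growthBound_of_memLp {h : Cn n → ℂ} (hd : Differentiable ℂ h) (hm : MemLp h 2 (gaussian n)) :
    GrowthBound (1 / 2) h := by
  refine ⟨‖hm.toLp h‖, norm_nonneg _, fun z => ?_⟩
  rw [← reproducing hd hm z]
  change ‖kernelIntegral h z‖ ≤ _
  rw [← kernelIntegral_congr hm.coeFn_toLp, ← inner_kernelVec, ← norm_kernelVec z, mul_comm]
  exact norm_inner_le_norm _ _

lemma subGaussian_of_growthBound_half {h : Cn n → ℂ} (hd : Differentiable ℂ h)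
    (hb : GrowthBound (1 / 2) h) : SubGaussian h :=
  ⟨hd.continuous.measurable, _, by norm_num, hb⟩

/-- The parameter `a` is the share of `‖z‖‖w‖` charged to the integrated variable; a larger `a`
gives slower growth of the result. -/
lemma growthBound_kernelIntegral {H : Cn n → ℂ} {a c : ℝ} (ha : 0 < a) (hac : c + a < 1)
    (h : GrowthBound c H) : GrowthBound (1 / (4 * a)) (kernelIntegral H) := by
  obtain ⟨C, hC, hH⟩ := h
  refine ⟨∫ w : Cn n, C * Real.exp ((c + a) * ‖w‖ ^ 2) ∂(gaussian n),
    integral_nonneg fun w => by positivity, fun z => ?_⟩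
  rw [← integral_mul_const]
  refine norm_integral_le_of_norm_le (((integrable_exp_sq hac).const_mul _).mul_const _)
    (ae_of_all _ fun w => ?_)
  rw [norm_mul]
  calc _ ≤ C * Real.exp (c * ‖w‖ ^ 2) * Real.exp (‖z‖ * ‖w‖) :=
        mul_le_mul (hH w) (norm_kernel_le z w) (norm_nonneg _) (by positivity)
    _ = C * Real.exp (c * ‖w‖ ^ 2 + ‖z‖ * ‖w‖) := by rw [Real.exp_add]; ring
    _ ≤ C * Real.exp ((c + a) * ‖w‖ ^ 2 + 1 / (4 * a) * ‖z‖ ^ 2) := by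
        refine mul_le_mul_of_nonneg_left (Real.exp_le_exp.2 ?_) hC
        have := mul_le_weighted ‖z‖ ‖w‖ ha
        rw [one_div_mul_eq_div]
        linarith
    _ = _ := by rw [Real.exp_add]; ring

/-! ### Toeplitz operators in integral form -/

lemma toeplitzInt_eq (φ h : Cn n → ℂ) : toeplitzInt φ h = kernelIntegral (fun w => φ w * h w) :=
  rfl

lemma Tame.toeplitzConv {φ h : Cn n → ℂ} (hφ : Tame φ) (h' : SubGaussian h) : ToeplitzConv φ h :=
  (hφ.mul_subGaussian h').integrable_mul_kernel

lemma Tame.differentiable_toeplitzInt {φ h : Cn n → ℂ} (hφ : Tame φ) (h' : SubGaussian h) :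
    Differentiable ℂ (toeplitzInt φ h) :=
  (hφ.mul_subGaussian h').differentiable_kernelIntegral

lemma Tame.subGaussian_toeplitzInt {φ h : Cn n → ℂ} (hφ : Tame φ) (hd : Differentiable ℂ h)
    (hb : GrowthBound (1 / 2) h) : SubGaussian (toeplitzInt φ h) :=
  ⟨(hφ.differentiable_toeplitzInt
      (subGaussian_of_growthBound_half hd hb)).continuous.measurable, _, by norm_num,
    -- Here `1/16 + 1/2 + 3/8 = 15/16 < 1`, and the resulting exponent is `1/(4a) = 2/3 < 1`.
    growthBound_kernelIntegral (a := 3 / 8) (by norm_num) (by norm_num)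
      ((hφ.growth (1 / 16) (by norm_num)).mul hb)⟩

/-- The product `f · T_φ h` is entire and sub-Gaussian, so the outer integral reproduces it. -/
lemma toeplitzInt_toeplitzInt {f φ h : Cn n → ℂ} (hf : Tame f) (hfd : Differentiable ℂ f)
    (hφ : Tame φ) (hd : Differentiable ℂ h) (hb : GrowthBound (1 / 2) h) (z : Cn n) :
    toeplitzInt f (toeplitzInt φ h) z = f z * toeplitzInt φ h z := by
  rw [toeplitzInt_eq f, (hf.mul_subGaussian (hφ.subGaussian_toeplitzInt hd hb)).kernelIntegral_eq
    (hfd.mul (hφ.differentiable_toeplitzInt (subGaussian_of_growthBound_half hd hb)))]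

/-- Multiplication by `K(·, z̄)` is adjoint to translation by `z`. -/
lemma toeplitzInt_conjFn {g h : Cn n → ℂ} (hg : Tame g) (hgd : Differentiable ℂ g)
    (hd : Differentiable ℂ h) (hb : GrowthBound (1 / 2) h) (z : Cn n) :
    toeplitzInt (conjFn g) h z = ∫ t, conj (g t) * h (z + t) ∂(gaussian n) := by
  have hh := subGaussian_of_growthBound_half hd hb
  -- Integrating over `w` first reproduces `h(z+t)`; integrating over `t` first reproduces
  -- `conj(g(w))`.
  let Φ : Cn n → Cn n → ℂ := fun t w => conj (g t) * (h w * kernel (z + t) w)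
  have hm : Measurable (Function.uncurry Φ) :=
    (Complex.continuous_conj.measurable.comp (hg.measurable.comp measurable_fst)).mul
      ((hh.measurable.comp measurable_snd).mul
        (measurable_kernel (measurable_fst.const_add z) measurable_snd))
  obtain ⟨C, hC, hCg⟩ := hg.growth (1 / 16) (by norm_num)
  obtain ⟨D, hD, hDh⟩ := hb
  have hi : Integrable (Function.uncurry Φ) ((gaussian n).prod (gaussian n)) := by
    refine integrable_prod_of_le hm (a := 3 / 4) (b := 15 / 16)
      (C := C * D * Real.exp (‖z‖ ^ 2 / (4 * (1 / 16)))) (by norm_num) (by norm_num) ?_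
    rintro ⟨t, w⟩
    simp only [Function.uncurry_apply_pair, Φ]
    rw [norm_mul, norm_mul, RCLike.norm_conj, kernel_add_left, norm_mul]
    calc _ ≤ (C * Real.exp (1 / 16 * ‖t‖ ^ 2)) * ((D * Real.exp (1 / 2 * ‖w‖ ^ 2)) *
          (Real.exp (‖z‖ * ‖w‖) * Real.exp (‖t‖ * ‖w‖))) := by
          gcongr
          · exact hCg t
          · exact hDh w
          · exact norm_kernel_le z w
          · exact norm_kernel_le t w
      _ = C * D * Real.exp (1 / 16 * ‖t‖ ^ 2 + 1 / 2 * ‖w‖ ^ 2 + ‖z‖ * ‖w‖ + ‖t‖ * ‖w‖) := by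
          simp only [Real.exp_add]; ring
      _ ≤ C * D * Real.exp (‖z‖ ^ 2 / (4 * (1 / 16)) +
          (3 / 4 * ‖t‖ ^ 2 + 15 / 16 * ‖w‖ ^ 2)) := by
          refine mul_le_mul_of_nonneg_left (Real.exp_le_exp.2 ?_) (by positivity)
          have h1 := mul_le_weighted ‖z‖ ‖w‖ (ε := 1 / 16) (by norm_num)
          have h2 := mul_le_weighted ‖t‖ ‖w‖ (ε := 3 / 8) (by norm_num)
          have h0 := sq_nonneg ‖t‖
          ring_nf at h1 h2 ⊢
          linarith
      _ = _ := by rw [Real.exp_add]; ring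
  have hswap := integral_integral_swap hi
  have h1 : ∀ t, ∫ w, Φ t w ∂(gaussian n) = conj (g t) * h (z + t) := fun t => by
    rw [← congrFun (hh.kernelIntegral_eq hd) (z + t)]
    exact integral_const_mul _ _
  have h2 : ∀ w, ∫ t, Φ t w ∂(gaussian n) = conjFn g w * h w * kernel z w := fun w => by
    have e : ∀ t, Φ t w = h w * kernel z w * conj (g t * kernel w t) := fun t => by
      simp only [Φ, kernel_add_left, map_mul, conj_kernel]; ring
    simp only [e]
    rw [integral_const_mul, integral_conj, conjFn,
      ← congrFun (hg.subGaussian.kernelIntegral_eq hgd) w, kernelIntegral]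
    ring
  simp only [h1, h2] at hswap
  exact hswap.symm

lemma Tame.comp_sub_const {f : Cn n → ℂ} (h : Tame f) (t : Cn n) : Tame (fun w => f (w - t)) := by
  refine ⟨h.measurable.comp (measurable_id.sub measurable_const), fun ε hε => ?_⟩
  obtain ⟨C, hC, hf⟩ := h.growth (ε / 2) (by positivity)
  refine ⟨C * Real.exp (ε * ‖t‖ ^ 2), by positivity, fun w => (hf _).trans ?_⟩
  rw [mul_assoc, ← Real.exp_add]
  refine mul_le_mul_of_nonneg_left (Real.exp_le_exp.2 ?_) hC
  nlinarith [norm_sub_sq_le w t]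

/-- After Fubini the kernels merge into `K(z+t,w)`, which reproduces `w ↦ f(w-t) h(w)` at `z+t`.
There the shift cancels, so `f(z)` leaves the integral. -/
lemma toeplitzInt_prodSymbol {f g h : Cn n → ℂ} (hf : Tame f) (hfd : Differentiable ℂ f)
    (hg : Tame g) (hgd : Differentiable ℂ g) (hd : Differentiable ℂ h)
    (hb : GrowthBound (1 / 2) h) (z : Cn n) :
    toeplitzInt (prodSymbol f g) h z = f z * ∫ t, conj (g t) * h (z + t) ∂(gaussian n) := by
  have hh := subGaussian_of_growthBound_half hd hb
  let Φ : Cn n → Cn n → ℂ := fun t w =>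
    conj (g t) * (f (w - t) * h w * kernel (z + t) w)
  have hm : Measurable (Function.uncurry Φ) :=
    (Complex.continuous_conj.measurable.comp (hg.measurable.comp measurable_fst)).mul
      (((hf.measurable.comp (measurable_snd.sub measurable_fst)).mul
        (hh.measurable.comp measurable_snd)).mul
        (measurable_kernel (measurable_fst.const_add z) measurable_snd))
  obtain ⟨C, hC, hCg⟩ := hg.growth (1 / 32) (by norm_num)
  obtain ⟨E, hE, hEf⟩ := hf.growth (1 / 64) (by norm_num)
  obtain ⟨D, hD, hDh⟩ := hb
  have hi : Integrable (Function.uncurry Φ) ((gaussian n).prod (gaussian n)) := by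
    -- Splitting `‖t‖‖w‖` with weight `3/8` gives `1/32 + 1/32 + 2/3 < 3/4` for `t` and `1/32 + 1/2
    -- + 1/32 + 3/8 = 15/16` for `w`.
    refine integrable_prod_of_le hm (a := 3 / 4) (b := 15 / 16)
      (C := C * E * D * Real.exp (‖z‖ ^ 2 / (4 * (1 / 32)))) (by norm_num) (by norm_num) ?_
    rintro ⟨t, w⟩
    simp only [Function.uncurry_apply_pair, Φ]
    rw [norm_mul, norm_mul, norm_mul, RCLike.norm_conj, kernel_add_left, norm_mul]
    calc _ ≤ (C * Real.exp (1 / 32 * ‖t‖ ^ 2)) * ((E * Real.exp (1 / 64 * ‖w - t‖ ^ 2)) *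
          (D * Real.exp (1 / 2 * ‖w‖ ^ 2)) *
          (Real.exp (‖z‖ * ‖w‖) * Real.exp (‖t‖ * ‖w‖))) := by
          gcongr
          · exact hCg t
          · exact hEf _
          · exact hDh w
          · exact norm_kernel_le z w
          · exact norm_kernel_le t w
      _ = C * E * D * Real.exp (1 / 32 * ‖t‖ ^ 2 + 1 / 64 * ‖w - t‖ ^ 2 + 1 / 2 * ‖w‖ ^ 2 +
          ‖z‖ * ‖w‖ + ‖t‖ * ‖w‖) := by
          simp only [Real.exp_add]; ring
      _ ≤ C * E * D * Real.exp (‖z‖ ^ 2 / (4 * (1 / 32)) +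
          (3 / 4 * ‖t‖ ^ 2 + 15 / 16 * ‖w‖ ^ 2)) := by
          refine mul_le_mul_of_nonneg_left (Real.exp_le_exp.2 ?_) (by positivity)
          have h1 := mul_le_weighted ‖z‖ ‖w‖ (ε := 1 / 32) (by norm_num)
          have h2 := mul_le_weighted ‖t‖ ‖w‖ (ε := 3 / 8) (by norm_num)
          have h3 := norm_sub_sq_le w t
          have h0 := sq_nonneg ‖t‖
          ring_nf at h1 h2 ⊢
          linarith
      _ = _ := by rw [Real.exp_add]; ring
  have hswap := integral_integral_swap hi
  have h1 : ∀ t, ∫ w, Φ t w ∂(gaussian n) = f z * (conj (g t) * h (z + t)) := fun t => by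
    have h3 := congrFun (((hf.comp_sub_const t).mul_subGaussian hh).kernelIntegral_eq
      ((hfd.comp (differentiable_id.sub_const t)).mul hd)) (z + t)
    simp only [add_sub_cancel_right] at h3
    rw [mul_left_comm, ← h3]
    exact integral_const_mul _ _
  have h2 : ∀ w, ∫ t, Φ t w ∂(gaussian n) = prodSymbol f g w * h w * kernel z w := fun w => by
    have e : ∀ t, Φ t w = h w * kernel z w * (conj (g t) * shifted f w t) := fun t => by
      simp only [Φ, kernel_add_left, shifted]; ring
    simp only [e]
    rw [integral_const_mul, prodSymbol_eq_integral hf hfd hg hgd]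
    ring
  simp only [h1, h2] at hswap
  rw [← integral_const_mul]
  exact hswap.symm

lemma toeplitzInt_mul_conj {f g h : Cn n → ℂ} (hf : Tame f) (hfd : Differentiable ℂ f)
    (hg : Tame g) (hgd : Differentiable ℂ g) (hd : Differentiable ℂ h)
    (hb : GrowthBound (1 / 2) h) :
    toeplitzInt f (toeplitzInt (conjFn g) h) = toeplitzInt (prodSymbol f g) h := by
  funext z
  rw [toeplitzInt_toeplitzInt hf hfd hg.conj hd hb, toeplitzInt_conjFn hg hgd hd hb,
    toeplitzInt_prodSymbol hf hfd hg hgd hd hb]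

lemma toeplitzInt_sum {ι : Type*} (s : Finset ι) {u : ι → Cn n → ℂ} {h : Cn n → ℂ}
    (hc : ∀ l ∈ s, ToeplitzConv (u l) h) :
    toeplitzInt (∑ l ∈ s, u l) h = ∑ l ∈ s, toeplitzInt (u l) h := by
  funext z
  rw [Finset.sum_apply]
  simp only [toeplitzInt, Finset.sum_apply, Finset.sum_mul]
  exact integral_finsetSum s fun l hl => hc l hl z

/-! ### Pointwise and essential growth bounds -/

/-- For continuous `F` the set where the bound fails is open, and a nonempty open set is not null.
-/
lemma growthBound_of_mem_growthSpace {c : ℝ} {F : Cn n → ℂ} (hF : F ∈ growthSpace n c)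
    (hc : Continuous F) : GrowthBound c F := by
  obtain ⟨_, C, hC⟩ := hF
  have hall : ∀ z, ‖F z * (Real.exp (-c * ‖z‖ ^ 2) : ℂ)‖ ≤ C := by
    by_contra! hne
    have hopen : IsOpen {z | C < ‖F z * (Real.exp (-c * ‖z‖ ^ 2) : ℂ)‖} :=
      isOpen_lt continuous_const (by fun_prop)
    refine hopen.measure_ne_zero volume hne ?_
    rw [ae_iff] at hC
    simpa only [not_le] using hC
  refine ⟨C, (norm_nonneg _).trans (hall 0), fun z => ?_⟩
  have h := hall z
  rw [norm_mul, Complex.norm_real, Real.norm_of_nonneg (Real.exp_pos _).le, neg_mul, Real.exp_neg,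
    ← div_eq_mul_inv, div_le_iff₀ (Real.exp_pos _)] at h
  exact h

lemma GrowthBound.mem_growthSpace {c : ℝ} {F : Cn n → ℂ} (h : GrowthBound c F)
    (hm : Measurable F) : F ∈ growthSpace n c := by
  obtain ⟨C, _, hC⟩ := h
  refine ⟨hm, C, ae_of_all _ fun z => ?_⟩
  rw [norm_mul, Complex.norm_real, Real.norm_of_nonneg (Real.exp_pos _).le, neg_mul, Real.exp_neg,
    ← div_eq_mul_inv, div_le_iff₀ (Real.exp_pos _)]
  exact hC z

lemma tame_of_mem_symSpace {f : Cn n → ℂ} (h : f ∈ symSpace n) (hd : Differentiable ℂ f) :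
    Tame f :=
  ⟨hd.continuous.measurable, fun c hc => growthBound_of_mem_growthSpace (h c hc) hd.continuous⟩

lemma Tame.mem_symSpace {f : Cn n → ℂ} (h : Tame f) : f ∈ symSpace n := fun c hc =>
  (h.growth c hc).mem_growthSpace h.measurable

lemma tame_sum {ι : Type*} (s : Finset ι) {u : ι → Cn n → ℂ} (hu : ∀ l ∈ s, Tame (u l)) :
    Tame (∑ l ∈ s, u l) := by
  refine Finset.sum_induction u Tame (fun a b ha hb => ?_) ?_ hu
  · exact ⟨ha.measurable.add hb.measurable, fun ε hε => by
      have := (ha.growth ε hε).add (hb.growth ε hε)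
      rwa [max_self] at this⟩
  · exact ⟨measurable_const, fun ε _ => ⟨0, le_rfl, fun w => by simp⟩⟩

/-! ### The unbounded operators -/

lemma kernelVec_mem (z : Cn n) : kernelVec z ∈ fockSpace n :=
  ⟨_, differentiable_kernel_left z, kernelVec_ae z⟩

lemma exists_entire_rep (h : fockSpace n) : ∃ H : Cn n → ℂ, Differentiable ℂ H ∧
    MemLp H 2 (gaussian n) ∧ ((h : Lp ℂ 2 (gaussian n)) : Cn n → ℂ) =ᵐ[gaussian n] H := by
  obtain ⟨H, hH, hae⟩ := h.2
  exact ⟨H, hH, (memLp_congr_ae hae).1 (Lp.memLp _), hae⟩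

lemma coe_ae_kernelIntegral (h : fockSpace n) :
    ((h : Lp ℂ 2 (gaussian n)) : Cn n → ℂ) =ᵐ[gaussian n]
      kernelIntegral (h : Lp ℂ 2 (gaussian n)) := by
  obtain ⟨H, hH, hm, hae⟩ := exists_entire_rep h
  rw [kernelIntegral_congr hae]
  filter_upwards [hae] with z hz
  rw [hz]
  exact (reproducing hH hm z).symm

/-- Kernel functions lie in `F²`, so `v` and its projection have the same inner products with them.
-/
lemma projection_ae (v : Lp ℂ 2 (gaussian n)) :
    (((fockSpace n).orthogonalProjectionOnto v : Lp ℂ 2 (gaussian n)) : Cn n → ℂ)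
      =ᵐ[gaussian n] kernelIntegral v := by
  have e : kernelIntegral ((fockSpace n).orthogonalProjectionOnto v : Lp ℂ 2 (gaussian n)) =
      kernelIntegral v := by
    funext z
    rw [← inner_kernelVec, ← inner_kernelVec]
    exact Submodule.inner_orthogonalProjectionOnto_eq_of_mem_left ⟨_, kernelVec_mem z⟩ v
  rw [← e]
  exact coe_ae_kernelIntegral _

lemma mem_toeplitz_domain {φ : Cn n → ℂ} {h : fockSpace n} : h ∈ (toeplitz φ).domain ↔
    MemLp (fun w => φ w * (h : Lp ℂ 2 (gaussian n)) w) 2 (gaussian n) := Iff.rfl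

/-- The bridge from the Hilbert space operator to the integral form, valid on the whole natural
domain. -/
lemma toeplitz_ae {φ : Cn n → ℂ} {h : fockSpace n} (hh : h ∈ (toeplitz φ).domain) {H : Cn n → ℂ}
    (hH : ((h : Lp ℂ 2 (gaussian n)) : Cn n → ℂ) =ᵐ[gaussian n] H) :
    ((toeplitz φ ⟨h, hh⟩ : Lp ℂ 2 (gaussian n)) : Cn n → ℂ) =ᵐ[gaussian n] toeplitzInt φ H := by
  have hm := mem_toeplitz_domain.1 hh
  have e : toeplitzInt φ H = kernelIntegral (hm.toLp _) := by
    refine kernelIntegral_congr ?_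
    filter_upwards [hm.coeFn_toLp, hH] with w h1 h2
    rw [h1, h2]
  rw [e]
  exact projection_ae _

lemma mem_opMul_domain {E : Type*} [AddCommGroup E] [Module ℂ E] {S T : E →ₗ.[ℂ] E} {h : E} :
    h ∈ (opMul S T).domain ↔ ∃ hT : h ∈ T.domain, T ⟨h, hT⟩ ∈ S.domain := by
  constructor
  · rintro ⟨x, hx, rfl⟩
    exact ⟨x.2, hx⟩
  · rintro ⟨hT, hS⟩
    exact ⟨⟨h, hT⟩, hS, rfl⟩

lemma opMul_apply {E : Type*} [AddCommGroup E] [Module ℂ E] {S T : E →ₗ.[ℂ] E} {h : E}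
    (hh : h ∈ (opMul S T).domain) (hT : h ∈ T.domain) (hS : T ⟨h, hT⟩ ∈ S.domain) :
    opMul S T ⟨h, hh⟩ = S ⟨T ⟨h, hT⟩, hS⟩ := rfl

lemma mem_sum_domain {E ι : Type*} [AddCommGroup E] [Module ℂ E] (s : Finset ι)
    (S : ι → E →ₗ.[ℂ] E) {h : E} :
    h ∈ (∑ l ∈ s, S l).domain ↔ ∀ l ∈ s, h ∈ (S l).domain := by
  classical
  induction s using Finset.induction_on with
  | empty => simp
  | insert a s ha ih =>
    rw [Finset.sum_insert ha, LinearPMap.add_domain, Submodule.mem_inf, ih]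
    simp

lemma sum_linearPMap_apply {E ι : Type*} [AddCommGroup E] [Module ℂ E] (s : Finset ι)
    (S : ι → E →ₗ.[ℂ] E) {h : E} (v : ι → E)
    (hv : ∀ l ∈ s, ∀ hl : h ∈ (S l).domain, S l ⟨h, hl⟩ = v l)
    (hs : h ∈ (∑ l ∈ s, S l).domain) : (∑ l ∈ s, S l) ⟨h, hs⟩ = ∑ l ∈ s, v l := by
  classical
  induction s using Finset.induction_on with
  | empty => rfl
  | insert a s ha ih =>
    have hs' := hs
    rw [Finset.sum_insert ha] at hs'
    -- The proof of domain membership depends on the operator, so the equality of operators is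
    -- transported to values separately.
    have e : ∀ {A B : E →ₗ.[ℂ] E}, A = B → ∀ hA hB, A ⟨h, hA⟩ = B ⟨h, hB⟩ := by
      rintro A _ rfl _ _
      rfl
    rw [e (Finset.sum_insert ha) hs hs', Finset.sum_insert ha, ← hv a (Finset.mem_insert_self a s) hs'.1,
      ← ih (fun l hl => hv l (Finset.mem_insert_of_mem hl)) hs'.2]
    exact LinearPMap.add_apply _ _ _

lemma coe_sum_ae {ι : Type*} (s : Finset ι) (v : ι → fockSpace n) (A : ι → Cn n → ℂ)
    (h : ∀ l ∈ s, ((v l : Lp ℂ 2 (gaussian n)) : Cn n → ℂ) =ᵐ[gaussian n] A l) :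
    (((∑ l ∈ s, v l : fockSpace n) : Lp ℂ 2 (gaussian n)) : Cn n → ℂ)
      =ᵐ[gaussian n] ∑ l ∈ s, A l := by
  classical
  induction s using Finset.induction_on with
  | empty => exact Lp.coeFn_zero _ _ _
  | insert a s ha ih =>
    rw [Finset.sum_insert ha, Finset.sum_insert ha, Submodule.coe_add]
    exact (Lp.coeFn_add _ _).trans ((h a (Finset.mem_insert_self a s)).add
      (ih fun l hl => h l (Finset.mem_insert_of_mem hl)))

lemma fockSpace_ext {a b : fockSpace n} {A : Cn n → ℂ}
    (ha : ((a : Lp ℂ 2 (gaussian n)) : Cn n → ℂ) =ᵐ[gaussian n] A)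
    (hb : ((b : Lp ℂ 2 (gaussian n)) : Cn n → ℂ) =ᵐ[gaussian n] A) : a = b :=
  Subtype.ext (Lp.ext (ha.trans hb.symm))

/-! ### The core -/

lemma exists_growthBound_of_mem_fockCore {h : fockSpace n} (hh : h ∈ fockCore n) :
    ∃ c : ℝ, c < 1 / 2 ∧ ∃ F : Cn n → ℂ, Differentiable ℂ F ∧ GrowthBound c F ∧
      ((h : Lp ℂ 2 (gaussian n)) : Cn n → ℂ) =ᵐ[gaussian n] F := by
  obtain ⟨c, hc, F, ⟨hF, hFc⟩, hae⟩ := hh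
  exact ⟨c, hc, F, hF, growthBound_of_mem_growthSpace hFc (Differentiable.continuous hF), hae⟩

lemma fockCore_subset_toeplitz_domain {φ : Cn n → ℂ} (hφ : Tame φ) :
    fockCore n ⊆ (toeplitz φ).domain := by
  intro h hh
  obtain ⟨c, hc, F, hF, hb, hae⟩ := exists_growthBound_of_mem_fockCore hh
  refine mem_toeplitz_domain.2 ((memLp_congr_ae ?_).1 (memLp_two_of_growthBound
    (hφ.measurable.mul hF.continuous.measurable) (c := (1 / 2 - c) / 2 + c) (by linarith)
    ((hφ.growth ((1 / 2 - c) / 2) (by linarith)).mul hb)))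
  filter_upwards [hae] with w hw
  rw [hw, Pi.mul_apply]

/-- Toeplitz operators with tame symbols map the core into itself, so a second one can be applied.
-/
lemma fockCore_subset_opMul_domain {f φ : Cn n → ℂ} (hf : Tame f) (hφ : Tame φ) :
    fockCore n ⊆ (opMul (toeplitz f) (toeplitz φ)).domain := by
  intro h hh
  refine mem_opMul_domain.2 ⟨fockCore_subset_toeplitz_domain hφ hh, ?_⟩
  obtain ⟨c, hc, F, hF, hb, hae⟩ := exists_growthBound_of_mem_fockCore hh
  refine fockCore_subset_toeplitz_domain hf ?_
  have hφF := (hφ.growth ((1 / 2 - c) / 2) (by linarith)).mul hb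
  have hsub : SubGaussian (fun w => φ w * F w) :=
    ⟨hφ.measurable.mul hF.continuous.measurable, _, by linarith, hφF⟩
  set d := (1 / 2 - c) / 2 + c with hd
  have hd2 : d < 1 / 2 := by linarith
  -- The midpoint of `1/2` and `1 - d`: both `a > 1/2`, which makes `1/(4a) < 1/2`, and `d + a < 1`
  -- hold because `d < 1/2`.
  have hT := growthBound_kernelIntegral (a := 3 / 4 - d / 2) (by linarith) (by linarith) hφF
  refine ⟨1 / (4 * (3 / 4 - d / 2)), ?_, kernelIntegral (fun w => φ w * F w),
    ⟨hsub.differentiable_kernelIntegral,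
      hT.mem_growthSpace hsub.differentiable_kernelIntegral.continuous.measurable⟩,
    toeplitz_ae _ hae⟩
  exact one_div_lt_one_div_of_lt (by norm_num) (by linarith)

/-- The core as a subspace of the Fock space. -/
def fockCoreSubmodule (n : ℕ) : Submodule ℂ (fockSpace n) where
  carrier := fockCore n
  zero_mem' := ⟨0, by norm_num, 0, ⟨differentiable_const 0, measurable_const, 0, by simp⟩,
    Lp.coeFn_zero _ _ _⟩
  add_mem' := by
    intro a b ha hb
    obtain ⟨c, hc, F, hF, hFc, hFa⟩ := exists_growthBound_of_mem_fockCore ha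
    obtain ⟨d, hd, G, hG, hGd, hGb⟩ := exists_growthBound_of_mem_fockCore hb
    exact ⟨max c d, max_lt hc hd, F + G, ⟨hF.add hG,
      (hFc.add hGd).mem_growthSpace (hF.add hG).continuous.measurable⟩,
      (Lp.coeFn_add _ _).trans (hFa.add hGb)⟩
  smul_mem' := by
    intro r a ha
    obtain ⟨c, hc, F, hF, ⟨C, hC, hFc⟩, hFa⟩ := exists_growthBound_of_mem_fockCore ha
    refine ⟨c, hc, r • F, ⟨hF.const_smul r, GrowthBound.mem_growthSpace
      ⟨‖r‖ * C, by positivity, fun w => ?_⟩ (hF.const_smul r).continuous.measurable⟩,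
      (Lp.coeFn_smul _ _).trans (hFa.const_smul r)⟩
    rw [Pi.smul_apply, norm_smul, mul_assoc]
    exact mul_le_mul_of_nonneg_left (hFc w) (norm_nonneg _)

/-- The core contains every kernel function, and an element of `F²` orthogonal to all of them
vanishes pointwise. -/
lemma dense_fockCore (n : ℕ) : Dense (fockCore n) := by
  change Dense (fockCoreSubmodule n : Set (fockSpace n))
  rw [Submodule.dense_iff_topologicalClosure_eq_top, Submodule.topologicalClosure_eq_top_iff,
    Submodule.eq_bot_iff]
  intro x hx
  have hk : ∀ z, kernelIntegral (x : Lp ℂ 2 (gaussian n)) z = 0 := fun z => by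
    rw [← inner_kernelVec]
    have hmem : (⟨kernelVec z, kernelVec_mem z⟩ : fockSpace n) ∈ fockCoreSubmodule n :=
      ⟨1 / 4, by norm_num, _, ⟨differentiable_kernel_left z,
        (tame_kernel_left z).mem_symSpace _ (by norm_num)⟩, kernelVec_ae z⟩
    exact (Submodule.mem_orthogonal _ _).1 hx _ hmem
  refine fockSpace_ext (coe_ae_kernelIntegral x) ?_
  rw [funext hk]
  exact Lp.coeFn_zero _ _ _

end Fock

/-! ### The integral identity and its transfer to the unbounded operators -/

theorem corollaryc2 (n N : ℕ) (f g : Fin N → Fock.Cn n → ℂ)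
    (hf : ∀ l, f l ∈ Fock.symSpace n ∩ Fock.entire n)
    (hg : ∀ l, g l ∈ Fock.symSpace n ∩ Fock.entire n) :
    -- the series defining the symbols converge absolutely, and the symbols lie in `Sym(ℂⁿ)`
    (∀ l z, Summable (Fock.opTerm (Fock.starFn (g l)) (f l) z)) ∧
    (∀ l, Fock.prodSymbol (f l) (g l) ∈ Fock.symSpace n) ∧
    -- the identity on all of `F²`, with Toeplitz operators in integral form
    (∀ h : Fock.Cn n → ℂ, h ∈ Fock.entire n → MeasureTheory.MemLp h 2 (Fock.gaussian n) →
      (∀ l, Fock.ToeplitzConv (Fock.conjFn (g l)) h ∧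
        Fock.ToeplitzConv (f l) (Fock.toeplitzInt (Fock.conjFn (g l)) h) ∧
        Fock.ToeplitzConv (Fock.prodSymbol (f l) (g l)) h) ∧
      ∑ l, Fock.toeplitzInt (f l) (Fock.toeplitzInt (Fock.conjFn (g l)) h) =
        ∑ l, Fock.toeplitzInt (Fock.prodSymbol (f l) (g l)) h ∧
      ∑ l, Fock.toeplitzInt (f l) (Fock.toeplitzInt (Fock.conjFn (g l)) h) =
        Fock.toeplitzInt (∑ l, Fock.prodSymbol (f l) (g l)) h) ∧
    -- the identity between the unbounded operators `P M_φ` on the Hilbert space `F²`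
    Dense (Fock.fockCore n) ∧
    Fock.AgreeOn (Fock.fockCore n)
      (∑ l, Fock.opMul (Fock.toeplitz (f l)) (Fock.toeplitz (Fock.conjFn (g l))))
      (∑ l, Fock.toeplitz (Fock.prodSymbol (f l) (g l))) ∧
    Fock.AgreeOn (Fock.fockCore n)
      (∑ l, Fock.opMul (Fock.toeplitz (f l)) (Fock.toeplitz (Fock.conjFn (g l))))
      (Fock.toeplitz (∑ l, Fock.prodSymbol (f l) (g l))) := by
  have hfd : ∀ l, Differentiable ℂ (f l) := fun l => (hf l).2
  have hgd : ∀ l, Differentiable ℂ (g l) := fun l => (hg l).2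
  have hft : ∀ l, Fock.Tame (f l) := fun l => Fock.tame_of_mem_symSpace (hf l).1 (hfd l)
  have hgt : ∀ l, Fock.Tame (g l) := fun l => Fock.tame_of_mem_symSpace (hg l).1 (hgd l)
  have hut : ∀ l, Fock.Tame (Fock.prodSymbol (f l) (g l)) := fun l =>
    Fock.tame_prodSymbol (hft l) (hfd l) (hgt l) (hgd l)
  have hint : ∀ h : Fock.Cn n → ℂ, Differentiable ℂ h → MemLp h 2 (Fock.gaussian n) →
      (∀ l, Fock.ToeplitzConv (Fock.conjFn (g l)) h ∧
        Fock.ToeplitzConv (f l) (Fock.toeplitzInt (Fock.conjFn (g l)) h) ∧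
        Fock.ToeplitzConv (Fock.prodSymbol (f l) (g l)) h) ∧
      ∑ l, Fock.toeplitzInt (f l) (Fock.toeplitzInt (Fock.conjFn (g l)) h) =
        ∑ l, Fock.toeplitzInt (Fock.prodSymbol (f l) (g l)) h ∧
      ∑ l, Fock.toeplitzInt (f l) (Fock.toeplitzInt (Fock.conjFn (g l)) h) =
        Fock.toeplitzInt (∑ l, Fock.prodSymbol (f l) (g l)) h := by
    intro h hd hm
    have hb := Fock.growthBound_of_memLp hd hm
    have hs := Fock.subGaussian_of_growthBound_half hd hb
    have hsum : ∑ l, Fock.toeplitzInt (f l) (Fock.toeplitzInt (Fock.conjFn (g l)) h) =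
        ∑ l, Fock.toeplitzInt (Fock.prodSymbol (f l) (g l)) h :=
      Finset.sum_congr rfl fun l _ =>
        Fock.toeplitzInt_mul_conj (hft l) (hfd l) (hgt l) (hgd l) hd hb
    refine ⟨fun l => ⟨(hgt l).conj.toeplitzConv hs,
      (hft l).toeplitzConv ((hgt l).conj.subGaussian_toeplitzInt hd hb),
      (hut l).toeplitzConv hs⟩, hsum, hsum.trans ?_⟩
    exact (Fock.toeplitzInt_sum _ fun l _ => (hut l).toeplitzConv hs).symm
  have hdom : Fock.fockCore n ⊆ (∑ l, Fock.opMul (Fock.toeplitz (f l))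
      (Fock.toeplitz (Fock.conjFn (g l)))).domain := fun h hh =>
    (Fock.mem_sum_domain _ _).2 fun l _ =>
      Fock.fockCore_subset_opMul_domain (hft l) (hgt l).conj hh
  -- On the full natural domain of the sum of products, its value is represented by the iterated
  -- integrals; no membership in the core is needed.
  have hleft : ∀ (h : Fock.fockSpace n) (hS : h ∈ (∑ l, Fock.opMul (Fock.toeplitz (f l))
      (Fock.toeplitz (Fock.conjFn (g l)))).domain) (H : Fock.Cn n → ℂ),
      ((h : Lp ℂ 2 (Fock.gaussian n)) : Fock.Cn n → ℂ) =ᵐ[Fock.gaussian n] H →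
      (((∑ l, Fock.opMul (Fock.toeplitz (f l)) (Fock.toeplitz (Fock.conjFn (g l)))) ⟨h, hS⟩ :
        Lp ℂ 2 (Fock.gaussian n)) : Fock.Cn n → ℂ) =ᵐ[Fock.gaussian n]
        ∑ l, Fock.toeplitzInt (f l) (Fock.toeplitzInt (Fock.conjFn (g l)) H) := by
    intro h hS H hH
    have hl := fun l => (Fock.mem_sum_domain _ _).1 hS l (Finset.mem_univ l)
    rw [Fock.sum_linearPMap_apply _ _ (fun l => Fock.opMul (Fock.toeplitz (f l))
      (Fock.toeplitz (Fock.conjFn (g l))) ⟨h, hl l⟩) (fun l _ _ => rfl) hS]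
    refine Fock.coe_sum_ae _ _ _ fun l _ => ?_
    obtain ⟨h1, h2⟩ := Fock.mem_opMul_domain.1 (hl l)
    rw [Fock.opMul_apply (hl l) h1 h2]
    exact Fock.toeplitz_ae h2 (Fock.toeplitz_ae h1 hH)
  refine ⟨fun l z => (Fock.hasSum_opTerm (hft l) (hfd l) (hgt l) (hgd l) z one_pos).summable,
    fun l => (hut l).mem_symSpace, hint, Fock.dense_fockCore n,
    ⟨hdom, fun h hh => (Fock.mem_sum_domain _ _).2 fun l _ =>
      Fock.fockCore_subset_toeplitz_domain (hut l) hh, fun h hS hT => ?_⟩,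
    ⟨hdom, Fock.fockCore_subset_toeplitz_domain (Fock.tame_sum _ fun l _ => hut l),
      fun h hS hT => ?_⟩⟩
  -- An entire representative makes the integral identity available, so agreement reaches every
  -- common element of the domains.
  · obtain ⟨H, hH, hm, hae⟩ := Fock.exists_entire_rep h
    refine Fock.fockSpace_ext (hleft h hS H hae) ?_
    have hl := fun l => (Fock.mem_sum_domain _ _).1 hT l (Finset.mem_univ l)
    rw [(hint H hH hm).2.1, Fock.sum_linearPMap_apply _ _ (fun l =>
      Fock.toeplitz (Fock.prodSymbol (f l) (g l)) ⟨h, hl l⟩) (fun l _ _ => rfl) hT]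
    exact Fock.coe_sum_ae _ _ _ fun l _ => Fock.toeplitz_ae (hl l) hae
  · obtain ⟨H, hH, hm, hae⟩ := Fock.exists_entire_rep h
    refine Fock.fockSpace_ext (hleft h hS H hae) ?_
    rw [(hint H hH hm).2.2]
    exact Fock.toeplitz_ae hT hae
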